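/- Let $v=v(x,y)$ be a real-valued, smooth, compactly supported function on $\mathbb R^2$. Put $$M_k=\int_{\mathbb R}\max_{x}|\partial_x^k v(x,y)|\,dy,\qquad N_k=\int_{\mathbb R}\Big(\int_{\mathbb R}|\partial_x^k v(x,y)|^2dx\Big)^{1/2}dy,$$ $$B_0=M_1,\quad B_1=e^{M_2}-1,\quad B_2=M_3(1+B_1)^3,\quad B_3=3M_3(1+B_1)^2B_2+M_4(1+B_1)^4,$$ $$\hat B_0=\frac{N_1}{\sqrt{1-B_1}},\qquad \hat B_1=\frac{(1+B_1)N_2}{\sqrt{1-B_1}},$$ and assume the small norm condition: 1. $B_0\le\frac14$, 2. $B_1\le\frac12$, 3. $8B_0+4B_2+2\sqrt2\,\hat B_0<\pi$, 4. $2B_1+\frac1\pi(64B_1+16\hat B_1)+\frac1\pi(8B_3+16B_2^2+56B_1+16B_1^2)\big(B_0+\frac2\pi[2B_0+\hat B_0]\big)<\tan\frac\pi8$. For $\lambda,\xi\in\mathbb R$ let $x(y)$ be the solution of $\frac{dx}{dy}=\lambda+v_x(x,y)$ with $x(y)-\lambda y\to\xi$ as $y\to-\infty$, and define the scattering datum $\sigma(\xi,\lambda)$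 by $x(y)-\lambda y\to\xi+\sigma(\xi,\lambda)$ as $y\to+\infty$. For fixed $\lambda\in\mathbb R$ let $\chi(\cdot,\lambda)$ be the solution of the shifted Riemann--Hilbert problem: $\chi(\cdot,\lambda)$ is holomorphic on $\mathbb C\setminus\mathbb R$, extends continuously to $\mathbb R$ from the upper and from the lower half-plane with boundary values $\chi_+(\cdot,\lambda)$ and $\chi_-(\cdot,\lambda)$ respectively, $\chi(\xi,\lambda)\to0$ as $|\xi|\to\infty$, and $$\sigma(\xi,\lambda)+\chi_+(\xi+\sigma(\xi,\lambda),\lambda)-\chi_-(\xi,\lambda)=0,\qquad \xi\in\mathbb R.$$ Then $\chi_\pm(\cdot,\lambda)$ are differentiable on $\mathbb R$, and for all $\lambda\in\mathbb R$ $$|\partial_\xi\chi_\pm(\xi,\lambda)|\le\tfrac14\tan\tfrac\pi8\quad(\xi\in\mathbb R),\qquad |\partial_\xi\chi(\xi,\lambda)|\le\tfrac14\tan\tfrac\pi8\quad(\xi\in\mathbb C\setminus\mathbb R).$$ -/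

import Mathlib

open Filter Topology MeasureTheory

namespace Pavlov

noncomputable section

/-- The partial derivative `∂ₓᵏ v (x, y)`. -/
def dx (k : ℕ) (v : ℝ × ℝ → ℝ) (x y : ℝ) : ℝ :=
  iteratedDeriv k (fun s => v (s, y)) x

/-- `∫ max_x |∂ₓᵏ v (x, y)| dy`. -/
def supInt (k : ℕ) (v : ℝ × ℝ → ℝ) : ℝ :=
  ∫ y, ⨆ x, |dx k v x y|

/-- `∫ (∫ |∂ₓᵏ v (x, y)|² dx)^{1/2} dy`. -/
def l2Int (k : ℕ) (v : ℝ × ℝ → ℝ) : ℝ :=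
  ∫ y, Real.sqrt (∫ x, |dx k v x y| ^ 2)

def B0 (v : ℝ × ℝ → ℝ) : ℝ := supInt 1 v

def B1 (v : ℝ × ℝ → ℝ) : ℝ := Real.exp (supInt 2 v) - 1

def B2 (v : ℝ × ℝ → ℝ) : ℝ := supInt 3 v * (1 + B1 v) ^ 3

def B3 (v : ℝ × ℝ → ℝ) : ℝ :=
  supInt 3 v * (3 * (1 + B1 v) ^ 2 * B2 v) + supInt 4 v * (1 + B1 v) ^ 4

/-- The constant written `B̂₀`. -/
def Bhat0 (v : ℝ × ℝ → ℝ) : ℝ := l2Int 1 v * (1 / Real.sqrt (1 - B1 v))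

/-- The constant written `B̂₁`. -/
def Bhat1 (v : ℝ × ℝ → ℝ) : ℝ := l2Int 2 v * ((1 + B1 v) / Real.sqrt (1 - B1 v))

/-- The small norm condition on a potential. -/
structure SmallNorm (v : ℝ × ℝ → ℝ) : Prop where
  cond1 : B0 v ≤ 1 / 4
  cond2 : B1 v ≤ 1 / 2
  cond3 : 8 * B0 v + 4 * B2 v + 2 * Real.sqrt 2 * Bhat0 v < Real.pi
  cond4 : 2 * B1 v + 1 / Real.pi * (64 * B1 v + 16 * Bhat1 v)
      + 1 / Real.pi * (8 * B3 v + 16 * B2 v ^ 2 + 56 * B1 v + 16 * B1 v ^ 2)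
        * (B0 v + 2 / Real.pi * (2 * B0 v + Bhat0 v))
      < Real.tan (Real.pi / 8)

/-- `y ↦ x y` is a (global) characteristic of `∂_y + (lam + v_x) ∂_x`, that is, it solves
`dx/dy = lam + v_x (x, y)`. -/
def IsCharacteristic (v : ℝ × ℝ → ℝ) (lam : ℝ) (x : ℝ → ℝ) : Prop :=
  ∀ y, HasDerivAt x (lam + dx 1 v (x y) y) y

/-- The characteristic with `x y - lam * y → ξ` as `y → -∞` satisfies
`x y - lam * y → ξ + s` as `y → +∞`. -/
def Scatters (v : ℝ × ℝ → ℝ) (ξ lam s : ℝ) : Prop :=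
  ∃ x : ℝ → ℝ, IsCharacteristic v lam x ∧
    Tendsto (fun y => x y - lam * y) atBot (𝓝 ξ) ∧
    Tendsto (fun y => x y - lam * y) atTop (𝓝 (ξ + s))

/-- The scattering datum `σ (ξ, lam)`: the number `s` with `Scatters v ξ lam s` (for smooth
compactly supported `v` it exists and is unique). -/
def sigma (v : ℝ × ℝ → ℝ) (ξ lam : ℝ) : ℝ :=
  Classical.epsilon (Scatters v ξ lam)

/-- `χ`, with boundary values `χp` (from the upper half-plane) and `χm` (from the lower
half-plane) on the real line, solves the Riemann–Hilbert problem with shift `s`. Only the values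
of `χ` off the real line matter. -/
structure IsShiftedRHSolution (s : ℝ → ℝ) (χ : ℂ → ℂ) (χp χm : ℝ → ℂ) : Prop where
  holomorphic : DifferentiableOn ℂ χ {z : ℂ | z.im ≠ 0}
  boundary_upper : ∀ ξ : ℝ, Tendsto χ (𝓝[{z : ℂ | 0 < z.im}] (ξ : ℂ)) (𝓝 (χp ξ))
  boundary_lower : ∀ ξ : ℝ, Tendsto χ (𝓝[{z : ℂ | z.im < 0}] (ξ : ℂ)) (𝓝 (χm ξ))
  jump : ∀ ξ : ℝ, (s ξ : ℂ) + χp (ξ + s ξ) - χm ξ = 0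
  decay : Tendsto χ (cocompact ℂ ⊓ 𝓟 {z : ℂ | z.im ≠ 0}) (𝓝 0)

end

end Pavlov

/-!
Put `s ξ = ξ + σ (ξ, lam)`, let `U` and `V` be the restrictions of `χ` to the closed upper and lower
half-planes, and `c = U ∘ s` on the real line, so that the jump relation reads
`V ξ = (s ξ - ξ) + c ξ`.

*The shift.* The difference of two characteristics satisfies a linear equation, so difference
quotients of `s` are exponentials of integrals of averages of `v_xx`
(`IsIntegrableField.characteristic_sub`). Hence `|s ξ - ξ| ≤ B₀`, `|s' - 1| ≤ B₁`, and `s'` is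
Lipschitz with constant `B₂` (`SmallNorm.exists_isNearId`). Of the small norm condition only
`B₀ ≤ 1/4`, `B₁ ≤ 0.01852` and `B₂ ≤ π/4` are needed.

*Representation.* For `z = x - iε`, Cauchy's formula gives `V'(z)` as an integral of `V` against
`1 / (t - z)²`, while the integral of `U` against `1 / (t - w)²` vanishes for every `w` in the lower
half-plane. Taking `w = s x - iε s'(x)`, pulling back by `s` and subtracting,
`-2πi V'(x - iε) = ∫ (shift difference) / (h + iε)² dh + ∫ (c (x + h) - c x) K dh`,
where the difference `K` of the two kernels (`weldKernel`) is only of size `1 / |h|` near `h = 0`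
and `1 / h²` at infinity (`deriv_lower_eq_integral`).

*Regularity.* Boundedness of `c` gives `|V'(x - iε)| = O(ε^(-1/2))`, hence Hölder continuity of `c` of
exponent `1/2`. With this gain the integrals are dominated uniformly in `ε`, so `V'` extends
continuously to the real line and `V` is differentiable there (`tendsto_deriv_lower`,
`hasDerivAt_lower`).

*Estimate.* At `ε = 0` the boundary derivative is `(s' - 1) / 2` plus an integral of second differences
of `s` plus the `K`-integral. The latter is controlled by the Lipschitz constant `L` of `c` for
`|h| ≤ 64`, and at larger distances by the growth of `c`, for which `|U'(z)| ≤ (1 + L_U) B₀ / (2 Im z)`,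
`L_U` the Lipschitz constant of `U` on the real line, suffices (`norm_upper_sub_le_sqrt`). Altogether
`L ≤ 0.06906 + 0.225 L`, hence `L ≤ 0.09` (`norm_boundaryDeriv_le`). The Poisson formula carries
Lipschitz bounds from the real line into the half-planes, and the resulting bound `0.1` is less than
`tan (π / 8) / 4 = (√2 - 1) / 4`.
-/

namespace Pavlov

open Complex

/-! ### Cauchy and Poisson formulas in a half-plane -/

theorem integrable_inv_norm_sub_sq (z : ℂ) (hz : z.im ≠ 0) :
    Integrable (fun x : ℝ => (‖(x : ℂ) - z‖ ^ 2)⁻¹) ∧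
      ∫ x : ℝ, (‖(x : ℂ) - z‖ ^ 2)⁻¹ = Real.pi / |z.im| := by
  have h1 : ∀ x : ℝ, (‖(x : ℂ) - z‖ ^ 2)⁻¹
      = (|z.im| ^ 2)⁻¹ * (1 + ((x - z.re) / |z.im|) ^ 2)⁻¹ := by
    intro x
    have h0 : |z.im| ≠ 0 := abs_ne_zero.mpr hz
    rw [← Complex.normSq_eq_norm_sq, Complex.normSq_apply, ← mul_inv]
    congr 1
    field_simp
    simp only [sub_re, ofReal_re, sub_im, ofReal_im, zero_sub, sq_abs]
    ring
  have h0 : 0 < |z.im| := abs_pos.mpr hz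
  have hi : Integrable (fun x : ℝ => (1 + ((x - z.re) / |z.im|) ^ 2)⁻¹) :=
    (integrable_inv_one_add_sq.comp_div h0.ne').comp_sub_right z.re
  simp_rw [h1]
  refine ⟨hi.const_mul _, ?_⟩
  rw [integral_const_mul, integral_sub_right_eq_self (fun x => (1 + (x / |z.im|) ^ 2)⁻¹) z.re,
    Measure.integral_comp_div (fun x => (1 + x ^ 2)⁻¹) |z.im|, integral_univ_inv_one_add_sq]
  simp only [abs_abs, smul_eq_mul]
  field_simp

theorem integrable_div_sub_sq {g : ℝ → ℂ} (hg : Continuous g) {N : ℝ} (hN : ∀ x, ‖g x‖ ≤ N) {w : ℂ}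
    (hw : w.im ≠ 0) : Integrable (fun x : ℝ => g x / ((x : ℂ) - w) ^ 2) := by
  have hx : ∀ x : ℝ, (x : ℂ) - w ≠ 0 := by
    intro x h; apply hw; have := congrArg Complex.im h; simpa using this
  refine Integrable.mono' ((integrable_inv_norm_sub_sq w hw).1.const_mul N)
    (hg.div (by fun_prop) fun x => pow_ne_zero 2 (hx x)).aestronglyMeasurable
    (Eventually.of_forall fun x => ?_)
  rw [norm_div, norm_pow, div_eq_mul_inv]
  gcongr
  exact hN x

/-- Cauchy's theorem in the upper half-plane for functions of quadratic decay. -/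
theorem integral_eq_zero_of_quadratic_decay {F : ℂ → ℂ} {w : ℂ} {C : ℝ}
    (hc : ContinuousOn F {z | 0 ≤ z.im}) (hd : DifferentiableOn ℂ F {z | 0 < z.im})
    (hw : w.im < 0) (hF : ∀ z : ℂ, 0 ≤ z.im → ‖F z‖ ≤ C / ‖z - w‖ ^ 2) :
    ∫ x : ℝ, F x = 0 := by
  have hC : 0 ≤ C := by
    have h := (norm_nonneg _).trans (hF 0 le_rfl)
    have : 0 < ‖(0 : ℂ) - w‖ ^ 2 := by
      have : (0 : ℂ) - w ≠ 0 := by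
        intro h; apply hw.ne; have := congrArg Complex.im h; simpa using this
      positivity
    by_contra hneg
    exact absurd h (not_le.mpr (div_neg_of_neg_of_pos (not_le.mp hneg) this))
  have hcr : Continuous (fun x : ℝ => F x) :=
    hc.comp_continuous Complex.continuous_ofReal (fun x => by simp)
  have hint : Integrable (fun x : ℝ => F x) := by
    refine Integrable.mono' ((integrable_inv_norm_sub_sq w hw.ne).1.const_mul C)
      hcr.aestronglyMeasurable (Eventually.of_forall fun x => ?_)
    simpa [div_eq_mul_inv] using hF x (by simp)
  have ht : Tendsto (fun R : ℝ => ∫ x in (w.re - R)..(w.re + R), F x) atTop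
      (𝓝 (∫ x : ℝ, F x)) :=
    intervalIntegral_tendsto_integral hint
      (tendsto_atBot_add_const_left _ _ tendsto_neg_atTop_atBot)
      (tendsto_atTop_add_const_left _ _ tendsto_id)
  refine tendsto_nhds_unique ht ?_
  have hbound : ∀ R : ℝ, 0 < R → ‖∫ x in (w.re - R)..(w.re + R), F x‖ ≤ 4 * C / R := by
    intro R hR
    have key : ∀ z : ℂ, 0 ≤ z.im → R ≤ ‖z - w‖ → ‖F z‖ ≤ C / R ^ 2 := by
      intro z hz hzR
      refine (hF z hz).trans ?_
      gcongr
    have h := Complex.integral_boundary_rect_eq_zero_of_continuousOn_of_differentiableOn F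
      (⟨w.re - R, 0⟩ : ℂ) (⟨w.re + R, R⟩ : ℂ) (hc.mono ?_) (hd.mono ?_)
    · simp only [ofReal_zero, zero_mul, add_zero] at h
      have e : (∫ x in (w.re - R)..(w.re + R), F x)
          = (∫ x in (w.re - R)..(w.re + R), F (x + R * I))
            - I • (∫ y in (0:ℝ)..R, F ((w.re + R : ℝ) + y * I))
            + I • (∫ y in (0:ℝ)..R, F ((w.re - R : ℝ) + y * I)) := by
        linear_combination h
      have b1 : ‖∫ x in (w.re - R)..(w.re + R), F (x + R * I)‖
          ≤ C / R ^ 2 * |(w.re + R) - (w.re - R)| := by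
        refine intervalIntegral.norm_integral_le_of_norm_le_const fun x _ => key _ (by simpa using hR.le) ?_
        refine le_trans ?_ (Complex.abs_im_le_norm _)
        rw [le_abs]; left; simp; linarith
      have b2 : ‖∫ y in (0:ℝ)..R, F ((w.re + R : ℝ) + y * I)‖ ≤ C / R ^ 2 * |R - 0| := by
        refine intervalIntegral.norm_integral_le_of_norm_le_const fun x hx => key _ ?_ ?_
        · rw [Set.uIoc_of_le hR.le] at hx; simpa using hx.1.le
        refine le_trans ?_ (Complex.abs_re_le_norm _)
        rw [le_abs]; left; simp
      have b3 : ‖∫ y in (0:ℝ)..R, F ((w.re - R : ℝ) + y * I)‖ ≤ C / R ^ 2 * |R - 0| := by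
        refine intervalIntegral.norm_integral_le_of_norm_le_const fun x hx => key _ ?_ ?_
        · rw [Set.uIoc_of_le hR.le] at hx; simpa using hx.1.le
        refine le_trans ?_ (Complex.abs_re_le_norm _)
        rw [le_abs]; right; simp
      have e1 : |(w.re + R) - (w.re - R)| = 2 * R := by rw [abs_of_nonneg] <;> linarith
      have e2 : |R - 0| = R := by rw [sub_zero, abs_of_pos hR]
      rw [e1] at b1; rw [e2] at b2 b3
      rw [e]
      refine (norm_add_le _ _).trans ?_
      refine (add_le_add_left (norm_sub_le _ _) _).trans ?_
      rw [norm_smul, norm_smul, Complex.norm_I, one_mul, one_mul]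
      have : C / R ^ 2 * (2 * R) + C / R ^ 2 * R + C / R ^ 2 * R = 4 * C / R := by
        field_simp; ring
      linarith
    · intro z hz
      have := hz.2
      simp only [Set.mem_preimage, Set.uIcc_of_le hR.le] at this
      exact this.1
    · intro z hz
      have := hz.2
      simp only [Set.mem_preimage, min_eq_left hR.le] at this
      exact this.1
  refine squeeze_zero_norm' (a := fun R => 4 * C / R) ?_ (tendsto_const_nhds.div_atTop tendsto_id)
  filter_upwards [eventually_gt_atTop 0] with R hR using hbound R hR

theorem norm_sub_mul_conj (x : ℝ) (z : ℂ) :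
    ((x : ℂ) - z) * ((x : ℂ) - (starRingEnd ℂ) z) = ((‖(x : ℂ) - z‖ ^ 2 : ℝ) : ℂ) := by
  have := Complex.mul_conj' ((x : ℂ) - z)
  simpa using this

/-- A bounded function, continuous on the closed upper half-plane and holomorphic inside. -/
structure IsUpperBdd (f : ℂ → ℂ) : Prop where
  cont : ContinuousOn f {z | 0 ≤ z.im}
  diff : DifferentiableOn ℂ f {z | 0 < z.im}
  bdd : ∃ M : ℝ, ∀ z : ℂ, 0 ≤ z.im → ‖f z‖ ≤ M

theorem IsUpperBdd.const (a : ℂ) : IsUpperBdd fun _ => a :=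
  ⟨continuousOn_const, differentiableOn_const _, ‖a‖, fun _ _ => le_rfl⟩

theorem isOpen_upper : IsOpen {z : ℂ | 0 < z.im} := isOpen_lt continuous_const continuous_im

namespace IsUpperBdd

variable {f : ℂ → ℂ}

theorem differentiableAt (hf : IsUpperBdd f) {z : ℂ} (hz : 0 < z.im) : DifferentiableAt ℂ f z :=
  hf.diff.differentiableAt (isOpen_upper.mem_nhds hz)

theorem continuous_real (hf : IsUpperBdd f) : Continuous (fun x : ℝ => f x) :=
  hf.cont.comp_continuous Complex.continuous_ofReal (fun x => by simp)

theorem integral_div_sq_eq_zero (hf : IsUpperBdd f) {w : ℂ} (hw : w.im < 0) :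
    ∫ x : ℝ, f x / ((x : ℂ) - w) ^ 2 = 0 := by
  obtain ⟨M, hM⟩ := hf.bdd
  have hne : ∀ z : ℂ, 0 ≤ z.im → (z - w) ^ 2 ≠ 0 := by
    intro z hz h
    have h2 := congrArg Complex.im (pow_eq_zero_iff two_ne_zero |>.mp h)
    simp at h2; linarith
  refine integral_eq_zero_of_quadratic_decay (F := fun z => f z / (z - w) ^ 2) (w := w) (C := M)
    ?_ ?_ hw ?_
  · exact hf.cont.div (by fun_prop) hne
  · exact hf.diff.div (by fun_prop) fun z hz => hne z (le_of_lt hz)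
  · intro z hz
    rw [norm_div, norm_pow]
    gcongr
    exact hM z hz

theorem dslope (hf : IsUpperBdd f) {z : ℂ} (hz : 0 < z.im) : IsUpperBdd (dslope f z) := by
  have hn : {z : ℂ | 0 < z.im} ∈ 𝓝 z := isOpen_upper.mem_nhds hz
  have hn' : {z : ℂ | 0 ≤ z.im} ∈ 𝓝 z := mem_of_superset hn fun z (hz : 0 < z.im) => le_of_lt hz
  have hc : ContinuousOn (_root_.dslope f z) {z | 0 ≤ z.im} :=
    (continuousOn_dslope hn').mpr ⟨hf.cont, hf.differentiableAt hz⟩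
  refine ⟨hc, (Complex.differentiableOn_dslope hn).mpr hf.diff, ?_⟩
  obtain ⟨M, hM⟩ := hf.bdd
  have hK : IsCompact (Metric.closedBall z z.im) := isCompact_closedBall z z.im
  have hsub : Metric.closedBall z z.im ⊆ {z | 0 ≤ z.im} := by
    intro w hw
    rw [mem_closedBall_iff_norm] at hw
    have := (Complex.abs_im_le_norm _).trans hw
    rw [abs_le, Complex.sub_im] at this
    show 0 ≤ w.im
    linarith [this.1]
  obtain ⟨M', hM'⟩ := hK.exists_bound_of_continuousOn (hc.mono hsub)
  refine ⟨max M' (2 * M / z.im), fun w hw => ?_⟩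
  by_cases h : w ∈ Metric.closedBall z z.im
  · exact (hM' w h).trans (le_max_left _ _)
  · refine le_trans ?_ (le_max_right _ _)
    rw [mem_closedBall_iff_norm, not_le] at h
    have hne : w ≠ z := by
      rintro rfl; simp at h; linarith
    rw [dslope_of_ne f hne, slope_def_field, norm_div]
    have h1 : ‖f w - f z‖ ≤ 2 * M := by
      refine (norm_sub_le _ _).trans ?_
      linarith [hM w hw, hM z hz.le]
    have h2 : 0 ≤ 2 * M := (norm_nonneg _).trans h1
    exact div_le_div₀ h2 h1 hz h.le

/-- Cauchy's theorem for `(f ζ - f z) / ((ζ - z) (ζ - z̄))`, whose singularity at `z` is removable. -/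
theorem integral_sub_div (hf : IsUpperBdd f) {z : ℂ} (hz : 0 < z.im) :
    ∫ x : ℝ, (f x - f z) / (((x : ℂ) - z) * ((x : ℂ) - (starRingEnd ℂ) z)) = 0 := by
  obtain ⟨M, hM⟩ := hf.bdd
  obtain ⟨M', hM'⟩ := (hf.dslope hz).bdd
  set w : ℂ := (starRingEnd ℂ) z
  have hw : w.im < 0 := by simp [w, hz]
  have hne : ∀ ζ : ℂ, 0 ≤ ζ.im → ζ - w ≠ 0 := by
    intro ζ hζ h
    have h2 := congrArg Complex.im h
    simp only [sub_im, zero_im] at h2; linarith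
  have h := integral_eq_zero_of_quadratic_decay (F := fun ζ => _root_.dslope f z ζ / (ζ - w)) (w := w)
    (C := 2 * M + M' * ‖z - w‖) ((hf.dslope hz).cont.div (by fun_prop) hne)
    ((hf.dslope hz).diff.div (by fun_prop) fun z hz => hne z (le_of_lt hz)) hw ?_
  · rw [← h]
    congr 1; ext x
    have hx : (x : ℂ) ≠ z := by
      rintro h; have := congrArg Complex.im h; simp at this; linarith
    rw [dslope_of_ne f hx, slope_def_field, div_div]
  · intro ζ hζ
    have h1 : ‖_root_.dslope f z ζ * (ζ - w)‖ ≤ 2 * M + M' * ‖z - w‖ := by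
      have e : _root_.dslope f z ζ * (ζ - w) = (f ζ - f z) + _root_.dslope f z ζ * (z - w) := by
        have := sub_smul_dslope f z ζ
        rw [smul_eq_mul] at this
        linear_combination this
      rw [e]
      refine (norm_add_le _ _).trans ?_
      refine add_le_add ((norm_sub_le _ _).trans ?_) ?_
      · linarith [hM ζ hζ, hM z hz.le]
      · rw [norm_mul]; gcongr; exact hM' ζ hζ
    have hp : 0 < ‖ζ - w‖ := norm_pos_iff.mpr (hne ζ hζ)
    rw [norm_div, div_le_div_iff₀ hp (by positivity)]
    rw [norm_mul] at h1
    nlinarith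

/-- Poisson's formula in the upper half-plane. -/
theorem integral_poisson (hf : IsUpperBdd f) {z : ℂ} (hz : 0 < z.im) :
    ∫ x : ℝ, f x * (((‖(x : ℂ) - z‖ ^ 2)⁻¹ : ℝ) : ℂ) = Real.pi / z.im * f z := by
  obtain ⟨M, hM⟩ := hf.bdd
  have hi := integrable_inv_norm_sub_sq z hz.ne'
  have h1 : Integrable (fun x : ℝ => f x * (((‖(x : ℂ) - z‖ ^ 2)⁻¹ : ℝ) : ℂ)) :=
    hi.1.ofReal.bdd_mul (c := M) hf.continuous_real.aestronglyMeasurable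
      (Eventually.of_forall fun x => hM x (by simp))
  have h2 : Integrable (fun x : ℝ => f z * (((‖(x : ℂ) - z‖ ^ 2)⁻¹ : ℝ) : ℂ)) :=
    hi.1.ofReal.const_mul _
  have h := hf.integral_sub_div hz
  simp_rw [norm_sub_mul_conj, sub_div, div_eq_mul_inv, ← Complex.ofReal_inv] at h
  rw [integral_sub h1 h2, sub_eq_zero] at h
  rw [h, integral_const_mul]
  have h3 : ∫ x : ℝ, (((‖(x : ℂ) - z‖ ^ 2)⁻¹ : ℝ) : ℂ) = ((Real.pi / z.im : ℝ) : ℂ) := by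
    rw [← abs_of_pos hz, ← hi.2]
    exact integral_ofReal
  rw [h3]
  push_cast
  ring

theorem norm_le_of_norm_real_le (hf : IsUpperBdd f) {A : ℝ} (hA : ∀ x : ℝ, ‖f x‖ ≤ A) {z : ℂ}
    (hz : 0 < z.im) : ‖f z‖ ≤ A := by
  have h := hf.integral_poisson hz
  have hi := integrable_inv_norm_sub_sq z hz.ne'
  have h2 : ‖∫ x : ℝ, f x * (((‖(x : ℂ) - z‖ ^ 2)⁻¹ : ℝ) : ℂ)‖
      ≤ ∫ x : ℝ, A * (‖(x : ℂ) - z‖ ^ 2)⁻¹ := by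
    refine norm_integral_le_of_norm_le (hi.1.const_mul A) (Eventually.of_forall fun x => ?_)
    rw [norm_mul, Complex.norm_of_nonneg (by positivity)]
    gcongr
    exact hA x
  rw [h, integral_const_mul, hi.2, abs_of_pos hz, norm_mul, norm_div, Complex.norm_of_nonneg hz.le,
    Complex.norm_of_nonneg Real.pi_pos.le, mul_comm] at h2
  exact le_of_mul_le_mul_right h2 (by positivity)

/-- The Cauchy formula for the derivative at a point of the upper half-plane. It is Poisson's formula
for the difference quotient `dslope f z`, whose value at `z` is `deriv f z`. -/
theorem integral_div_sq (hf : IsUpperBdd f) {z : ℂ} (hz : 0 < z.im) :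
    ∫ x : ℝ, f x / ((x : ℂ) - z) ^ 2 = 2 * Real.pi * I * deriv f z := by
  obtain ⟨M, hM⟩ := hf.bdd
  have hi := integrable_inv_norm_sub_sq z hz.ne'
  have hx : ∀ x : ℝ, (x : ℂ) - z ≠ 0 := by
    intro x h; have := congrArg Complex.im h; simp at this; linarith
  have hx' : ∀ x : ℝ, (x : ℂ) - (starRingEnd ℂ) z ≠ 0 := by
    intro x h; have := congrArg Complex.im h; simp at this; linarith
  have hint : ∀ g : ℂ → ℂ, IsUpperBdd g → Integrable (fun x : ℝ => g x / ((x : ℂ) - z) ^ 2) := by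
    intro g hg
    obtain ⟨N, hN⟩ := hg.bdd
    exact integrable_div_sub_sq hg.continuous_real (fun x => hN x (by simp)) hz.ne'
  have hconst : IsUpperBdd fun _ => f z := .const _
  -- the integral of `1 / (x - z)²` vanishes, by reflection from the lower half-plane
  have hzero : ∫ x : ℝ, f z / ((x : ℂ) - z) ^ 2 = 0 := by
    have h := hconst.integral_div_sq_eq_zero (w := -z) (by simpa using hz)
    rw [← integral_neg_eq_self] at h
    rw [← h]
    congr 1; ext x
    push_cast
    congr 1; ring
  have hP := (hf.dslope hz).integral_poisson hz
  rw [dslope_same] at hP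
  have h0 := hf.integral_sub_div hz
  have hI1 : Integrable (fun x : ℝ => (f x - f z) / ((x : ℂ) - z) ^ 2) := by
    simp_rw [sub_div]
    exact (hint f hf).sub (hint _ hconst)
  have hI2 : Integrable
      (fun x : ℝ => (f x - f z) / (((x : ℂ) - z) * ((x : ℂ) - (starRingEnd ℂ) z))) := by
    simp_rw [norm_sub_mul_conj, div_eq_mul_inv, ← Complex.ofReal_inv]
    refine hi.1.ofReal.bdd_mul (c := M + M) (hf.continuous_real.sub
      continuous_const).aestronglyMeasurable (Eventually.of_forall fun x => ?_)
    exact (norm_sub_le _ _).trans (add_le_add (hM x (by simp)) (hM z hz.le))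
  have e : ∀ x : ℝ, _root_.dslope f z x * (((‖(x : ℂ) - z‖ ^ 2)⁻¹ : ℝ) : ℂ)
      = (1 / (2 * I * z.im)) * ((f x - f z) / ((x : ℂ) - z) ^ 2
        - (f x - f z) / (((x : ℂ) - z) * ((x : ℂ) - (starRingEnd ℂ) z))) := by
    intro x
    have hne : (x : ℂ) ≠ z := sub_ne_zero.mp (hx x)
    have hzz : z = (starRingEnd ℂ) z + 2 * I * z.im := by
      apply Complex.ext <;> simp; ring
    have him : (z.im : ℂ) ≠ 0 := by exact_mod_cast hz.ne'
    rw [dslope_of_ne f hne, slope_def_field, Complex.ofReal_inv, ← norm_sub_mul_conj]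
    have h1 := hx x
    have h2 := hx' x
    generalize (starRingEnd ℂ) z = w at *
    have hw : 2 * I * z.im = z - w := by linear_combination -hzz
    have hw' : z - w ≠ 0 := by
      rw [← hw]; simp [him]
    rw [hw]
    field_simp
    ring
  simp_rw [e] at hP
  rw [integral_const_mul, integral_sub hI1 hI2, h0, sub_zero] at hP
  have h3 : ∫ x : ℝ, (f x - f z) / ((x : ℂ) - z) ^ 2 = ∫ x : ℝ, f x / ((x : ℂ) - z) ^ 2 := by
    simp_rw [sub_div]
    rw [integral_sub (hint f hf) (hint _ hconst), hzero, sub_zero]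
  rw [h3] at hP
  have him : (z.im : ℂ) ≠ 0 := by exact_mod_cast hz.ne'
  have hI : (I : ℂ) ≠ 0 := I_ne_zero
  field_simp at hP
  linear_combination hP

/-- The Poisson formula applied to the horizontal difference quotients of `f`. -/
theorem norm_deriv_le_of_lipschitz (hf : IsUpperBdd f) {L : ℝ}
    (hL : ∀ x y : ℝ, ‖f x - f y‖ ≤ L * |x - y|) {z : ℂ} (hz : 0 < z.im) : ‖deriv f z‖ ≤ L := by
  have hL0 : 0 ≤ L := by
    have := (norm_nonneg _).trans (hL 1 0); simpa using this
  obtain ⟨M, hM⟩ := hf.bdd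
  have key : ∀ t : ℝ, ‖f (z + t) - f z‖ ≤ L * |t| := by
    intro t
    have hg : IsUpperBdd fun ζ => f (ζ + t) - f ζ := by
      have hm : ∀ ζ : ℂ, (ζ + t).im = ζ.im := by simp
      refine ⟨(hf.cont.comp (by fun_prop) fun ζ hζ => ?_).sub hf.cont,
        (hf.diff.comp (by fun_prop) fun ζ hζ => ?_).sub hf.diff, M + M, fun ζ hζ => ?_⟩
      · simpa [hm] using hζ
      · simpa [hm] using hζ
      · exact (norm_sub_le _ _).trans (add_le_add (hM _ (by simpa [hm] using hζ)) (hM ζ hζ))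
    refine hg.norm_le_of_norm_real_le (fun x => ?_) hz
    have := hL (x + t) x
    simpa using this
  have hd : HasDerivAt (fun t : ℝ => f (z + t)) (deriv f z) 0 := by
    have h1 : HasDerivAt f (deriv f z) (z + ((0 : ℝ) : ℂ)) := by
      simpa using (hf.differentiableAt hz).hasDerivAt
    have h2 : HasDerivAt (fun t : ℝ => z + (t : ℂ)) 1 0 := by
      simpa using (Complex.ofRealCLM.hasDerivAt (x := (0 : ℝ))).const_add z
    have h3 := h1.comp (0 : ℝ) h2
    rw [mul_one] at h3
    exact h3
  refine hd.le_of_lip' hL0 (Eventually.of_forall fun t => ?_)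
  simpa using key t

/-- Hardy–Littlewood: growth `(Im z)^(-1/2)` of the derivative gives boundary values that are
Hölder continuous of exponent `1/2`. The path joining two boundary points goes up to the height of
their distance, across, and down. -/
theorem norm_sub_le_sqrt (hf : IsUpperBdd f) {M : ℝ} (hM0 : 0 ≤ M)
    (hM : ∀ z : ℂ, 0 < z.im → ‖deriv f z‖ ≤ M / √z.im) (x y : ℝ) :
    ‖f x - f y‖ ≤ 5 * M * √|x - y| := by
  rcases eq_or_ne x y with rfl | hxy
  · simp
  have hvert : ∀ x t : ℝ, 0 < t → ‖f (x + t * I) - f x‖ ≤ 2 * M * √t := by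
    intro x t ht
    have hpos : ∀ d ∈ Set.Ioc 0 t, ‖f (x + t * I) - f (x + d * I)‖ ≤ 2 * M * √t := by
      intro d hd
      have hder : ∀ y : ℝ, 0 < y → HasDerivAt (fun y : ℝ => f (x + y * I))
          (deriv f (x + y * I) * I) y := by
        intro y hy
        have h1 : HasDerivAt f (deriv f (x + y * I)) ((x : ℂ) + (y : ℂ) * I) :=
          (hf.differentiableAt (by simpa using hy)).hasDerivAt
        have h2 : HasDerivAt (fun y : ℝ => (x : ℂ) + (y : ℂ) * I) I y := by
          simpa using ((Complex.ofRealCLM.hasDerivAt (x := y)).mul_const I).const_add (x : ℂ)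
        exact h1.comp y h2
      have hB : ∀ y : ℝ, 0 < y → HasDerivAt (fun y : ℝ => 2 * M * (√y - √d)) (M / √y) y := by
        intro y hy
        have := ((Real.hasDerivAt_sqrt hy.ne').sub_const (√d)).const_mul (2 * M)
        refine this.congr_deriv ?_
        have : √y ≠ 0 := (Real.sqrt_pos.mpr hy).ne'
        field_simp
      have h := image_norm_le_of_norm_deriv_right_le_deriv_boundary'
        (f := fun y : ℝ => f (x + y * I) - f (x + d * I)) (f' := fun y => deriv f (x + y * I) * I)
        (a := d) (b := t) (B := fun y => 2 * M * (√y - √d)) (B' := fun y => M / √y)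
        (fun y hy => (((hder y (hd.1.trans_le hy.1)).sub_const _).continuousAt).continuousWithinAt)
        (fun y hy => ((hder y (hd.1.trans_le hy.1)).sub_const _).hasDerivWithinAt)
        (by simp)
        (fun y hy => (hB y (hd.1.trans_le hy.1)).continuousAt.continuousWithinAt)
        (fun y hy => (hB y (hd.1.trans_le hy.1)).hasDerivWithinAt)
        (fun y hy => by
          have := hM (x + y * I) (by simpa using hd.1.trans_le hy.1)
          simpa using this)
        (x := t) (Set.right_mem_Icc.mpr hd.2)
      refine h.trans ?_
      have := Real.sqrt_nonneg d
      gcongr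
      linarith
    have hlim : Tendsto (fun d : ℝ => ‖f (x + t * I) - f (x + d * I)‖) (𝓝[>] 0)
        (𝓝 ‖f (x + t * I) - f x‖) := by
      refine (tendsto_const_nhds.sub ?_).norm
      have h1 : Tendsto (fun d : ℝ => (x : ℂ) + d * I) (𝓝[>] 0) (𝓝[{z | 0 ≤ z.im}] (x : ℂ)) := by
        refine tendsto_nhdsWithin_iff.mpr ⟨?_, ?_⟩
        · have : Continuous fun d : ℝ => (x : ℂ) + d * I := by fun_prop
          simpa using (this.tendsto 0).mono_left nhdsWithin_le_nhds
        · filter_upwards [self_mem_nhdsWithin] with d hd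
          simpa using le_of_lt hd
      exact (hf.cont (x : ℂ) (by simp)).tendsto.comp h1
    refine le_of_tendsto hlim ?_
    filter_upwards [Ioc_mem_nhdsGT ht] with d hd using hpos d hd
  set h := |x - y| with hh
  have h0 : 0 < h := abs_pos.mpr (sub_ne_zero.mpr hxy)
  have hhor : ‖f (x + h * I) - f (y + h * I)‖ ≤ M / √h * ‖((x : ℂ) + h * I) - (y + h * I)‖ := by
    have hconv : Convex ℝ {z : ℂ | h ≤ z.im} := convex_halfSpace_im_ge h
    refine hconv.norm_image_sub_le_of_norm_deriv_le (𝕜 := ℂ)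
      (fun z (hz : h ≤ z.im) => hf.differentiableAt (h0.trans_le hz))
      (fun z (hz : h ≤ z.im) => (hM z (h0.trans_le hz)).trans ?_)
      (show h ≤ ((y : ℂ) + h * I).im by simp) (show h ≤ ((x : ℂ) + h * I).im by simp)
    gcongr
  have e1 : ‖((x : ℂ) + h * I) - (y + h * I)‖ = h := by
    rw [add_sub_add_right_eq_sub, ← Complex.ofReal_sub, Complex.norm_real, Real.norm_eq_abs]
  have e2 : M / √h * h = M * √h := by
    have := Real.div_sqrt (x := h)
    rw [div_mul_eq_mul_div, mul_div_assoc, this]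
  rw [e1, e2] at hhor
  have hx := hvert x h h0
  have hy := hvert y h h0
  have e : f x - f y = -(f (x + h * I) - f x) + (f (x + h * I) - f (y + h * I))
      + (f (y + h * I) - f y) := by ring
  rw [e]
  refine (norm_add_le _ _).trans ((add_le_add_left (norm_add_le _ _) _).trans ?_)
  rw [norm_neg]
  linarith

end IsUpperBdd

/-- A bounded function, continuous on the closed lower half-plane and holomorphic inside. -/
def IsLowerBdd (f : ℂ → ℂ) : Prop := IsUpperBdd fun z => f (-z)

namespace IsLowerBdd

variable {f : ℂ → ℂ}

theorem continuous_real (hf : IsLowerBdd f) : Continuous (fun x : ℝ => f x) := by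
  have := (IsUpperBdd.continuous_real hf).comp (continuous_neg (G := ℝ))
  refine this.congr fun x => ?_
  simp

theorem differentiableAt (hf : IsLowerBdd f) {z : ℂ} (hz : z.im < 0) :
    DifferentiableAt ℂ f z := by
  have h : DifferentiableAt ℂ (fun z => f (-z)) (-z) :=
    IsUpperBdd.differentiableAt hf (by simpa using hz)
  have := h.comp z (differentiable_neg.differentiableAt (x := z))
  refine this.congr_of_eventuallyEq (Eventually.of_forall fun w => ?_)
  simp

theorem deriv_comp_neg (z : ℂ) : deriv (fun z => f (-z)) (-z) = -deriv f z := by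
  rw [_root_.deriv_comp_neg, neg_neg]

theorem integral_comp_neg (w : ℂ) :
    ∫ x : ℝ, f (-x) / ((x : ℂ) - (-w)) ^ 2 = ∫ x : ℝ, f x / ((x : ℂ) - w) ^ 2 := by
  rw [← integral_neg_eq_self]
  congr 1; ext x
  push_cast
  rw [neg_neg]
  congr 1; ring

theorem integral_div_sq_eq_zero (hf : IsLowerBdd f) {w : ℂ} (hw : 0 < w.im) :
    ∫ x : ℝ, f x / ((x : ℂ) - w) ^ 2 = 0 := by
  rw [← integral_comp_neg]
  exact IsUpperBdd.integral_div_sq_eq_zero hf (w := -w) (by simpa using hw)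

theorem integral_div_sq (hf : IsLowerBdd f) {z : ℂ} (hz : z.im < 0) :
    ∫ x : ℝ, f x / ((x : ℂ) - z) ^ 2 = -(2 * Real.pi * I * deriv f z) := by
  rw [← integral_comp_neg]
  have := IsUpperBdd.integral_div_sq hf (z := -z) (by simpa using hz)
  rw [deriv_comp_neg] at this
  rw [this]; ring

theorem norm_deriv_le_of_lipschitz (hf : IsLowerBdd f) {L : ℝ}
    (hL : ∀ x y : ℝ, ‖f x - f y‖ ≤ L * |x - y|) {z : ℂ} (hz : z.im < 0) : ‖deriv f z‖ ≤ L := by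
  have := IsUpperBdd.norm_deriv_le_of_lipschitz hf (L := L) (fun x y => ?_) (z := -z)
    (by simpa using hz)
  · rwa [deriv_comp_neg, norm_neg] at this
  · have := hL (-x) (-y)
    rw [neg_sub_neg, abs_sub_comm] at this
    simpa using this

theorem norm_sub_le_sqrt (hf : IsLowerBdd f) {M : ℝ} (hM0 : 0 ≤ M)
    (hM : ∀ z : ℂ, z.im < 0 → ‖deriv f z‖ ≤ M / √(-z.im)) (x y : ℝ) :
    ‖f x - f y‖ ≤ 5 * M * √|x - y| := by
  have := IsUpperBdd.norm_sub_le_sqrt hf hM0 (fun z hz => ?_) (-x) (-y)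
  · rw [neg_sub_neg, abs_sub_comm] at this
    simpa using this
  · have h := hM (-z) (by simpa using hz)
    rw [← norm_neg, ← deriv_comp_neg] at h
    simpa using h

end IsLowerBdd

/-! ### Shifts close to the identity and the welding kernel -/

/-- `s` is a `C^{1,1}` perturbation of the identity with derivative `s'`: the shift `s x - x` is
bounded by `b₀`, its derivative by `β < 1`, and the derivative is `b₂`-Lipschitz. -/
structure IsNearId (s s' : ℝ → ℝ) (b₀ β b₂ : ℝ) : Prop where
  hasDerivAt : ∀ x, HasDerivAt s (s' x) x
  abs_sub_le : ∀ x, |s x - x| ≤ b₀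
  abs_deriv_sub_le : ∀ x, |s' x - 1| ≤ β
  lipschitz : ∀ x y, |s' x - s' y| ≤ b₂ * |x - y|
  lt_one : β < 1

namespace IsNearId

variable {s s' : ℝ → ℝ} {b₀ β b₂ : ℝ}

theorem beta_nonneg (hs : IsNearId s s' b₀ β b₂) : 0 ≤ β :=
  (abs_nonneg _).trans (hs.abs_deriv_sub_le 0)

theorem b₀_nonneg (hs : IsNearId s s' b₀ β b₂) : 0 ≤ b₀ :=
  (abs_nonneg _).trans (hs.abs_sub_le 0)

theorem b₂_nonneg (hs : IsNearId s s' b₀ β b₂) : 0 ≤ b₂ := by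
  have := (abs_nonneg _).trans (hs.lipschitz 1 0)
  simpa using this

theorem deriv_ge (hs : IsNearId s s' b₀ β b₂) (x : ℝ) : 1 - β ≤ s' x := by
  have := abs_le.mp (hs.abs_deriv_sub_le x); linarith [this.1]

theorem deriv_le (hs : IsNearId s s' b₀ β b₂) (x : ℝ) : s' x ≤ 1 + β := by
  have := abs_le.mp (hs.abs_deriv_sub_le x); linarith [this.2]

theorem deriv_pos (hs : IsNearId s s' b₀ β b₂) (x : ℝ) : 0 < s' x := by
  linarith [hs.deriv_ge x, hs.lt_one]

theorem continuous (hs : IsNearId s s' b₀ β b₂) : Continuous s :=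
  continuous_iff_continuousAt.mpr fun x => (hs.hasDerivAt x).continuousAt

theorem continuous_deriv (hs : IsNearId s s' b₀ β b₂) : Continuous s' := by
  have : LipschitzWith (Real.toNNReal b₂) s' := LipschitzWith.of_dist_le_mul fun x y => by
    rw [Real.dist_eq, Real.dist_eq, Real.coe_toNNReal _ hs.b₂_nonneg]
    exact hs.lipschitz x y
  exact this.continuous

/-- If `s'` stays within `e` of the number `p` between `x` and `x + h`, then `s` is within `e|h|` of
the affine function of slope `p`. -/
theorem abs_sub_sub_le (hs : IsNearId s s' b₀ β b₂) {x h p e : ℝ}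
    (he : ∀ t, |t - x| ≤ |h| → |t - (x + h)| ≤ |h| → |s' t - p| ≤ e) :
    |s (x + h) - s x - p * h| ≤ e * |h| := by
  have := (convex_uIcc x (x + h)).norm_image_sub_le_of_norm_hasDerivWithin_le
    (f := fun t => s t - p * t) (f' := fun t => s' t - p) (C := e)
    (fun t _ => (((hs.hasDerivAt t).sub (by simpa using (hasDerivAt_id t).const_mul p)).hasDerivWithinAt))
    (fun t ht => he t ?_ ?_) (Set.left_mem_uIcc) (Set.right_mem_uIcc)
  · simp only [Real.norm_eq_abs, add_sub_cancel_left] at this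
    convert this using 2
    ring
  · have := Set.abs_sub_left_of_mem_uIcc ht
    simpa using this
  · have := Set.abs_sub_right_of_mem_uIcc ht
    rw [abs_sub_comm]
    simpa using this

theorem taylor_left (hs : IsNearId s s' b₀ β b₂) (x h : ℝ) :
    |s (x + h) - s x - s' x * h| ≤ b₂ * |h| * |h| :=
  hs.abs_sub_sub_le fun t ht _ => (hs.lipschitz t x).trans
    (mul_le_mul_of_nonneg_left ht hs.b₂_nonneg)

theorem taylor_right (hs : IsNearId s s' b₀ β b₂) (x h : ℝ) :
    |s (x + h) - s x - s' (x + h) * h| ≤ b₂ * |h| * |h| :=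
  hs.abs_sub_sub_le fun t _ ht => (hs.lipschitz t (x + h)).trans
    (mul_le_mul_of_nonneg_left ht hs.b₂_nonneg)

theorem abs_deriv_sub_deriv_le (hs : IsNearId s s' b₀ β b₂) (x y : ℝ) : |s' x - s' y| ≤ 2 * β := by
  have h1 := abs_le.mp (hs.abs_deriv_sub_le x)
  have h2 := abs_le.mp (hs.abs_deriv_sub_le y)
  rw [abs_le]; constructor <;> linarith [h1.1, h1.2, h2.1, h2.2]

theorem abs_sub_sub_deriv_le (hs : IsNearId s s' b₀ β b₂) (x h y : ℝ) :
    |s (x + h) - s x - s' y * h| ≤ 2 * β * |h| :=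
  hs.abs_sub_sub_le fun t _ _ => hs.abs_deriv_sub_deriv_le t y

theorem abs_shift_sub_le (hs : IsNearId s s' b₀ β b₂) (x h : ℝ) :
    |s (x + h) - s x - h| ≤ β * |h| := by
  have := hs.abs_sub_sub_le (x := x) (h := h) (p := 1) (e := β) fun t _ _ => hs.abs_deriv_sub_le t
  simpa using this

theorem abs_shift_sub_le' (hs : IsNearId s s' b₀ β b₂) (x h : ℝ) :
    |s (x + h) - s x - h| ≤ 2 * b₀ := by
  have h1 := abs_le.mp (hs.abs_sub_le (x + h))
  have h2 := abs_le.mp (hs.abs_sub_le x)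
  rw [abs_le]; constructor <;> linarith [h1.1, h1.2, h2.1, h2.2]

theorem abs_image_sub_le (hs : IsNearId s s' b₀ β b₂) (x h : ℝ) :
    |s (x + h) - s x| ≤ (1 + β) * |h| := by
  have h1 := hs.abs_shift_sub_le x h
  have : s (x + h) - s x = (s (x + h) - s x - h) + h := by ring
  rw [this]
  refine (abs_add_le _ _).trans ?_
  linarith

theorem le_abs_image_sub (hs : IsNearId s s' b₀ β b₂) (x h : ℝ) :
    (1 - β) * |h| ≤ |s (x + h) - s x| := by
  have h1 := hs.abs_shift_sub_le x h
  have h3 : |h| - |s (x + h) - s x| ≤ |h - (s (x + h) - s x)| := abs_sub_abs_le_abs_sub _ _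
  rw [abs_sub_comm h] at h3
  linarith

theorem strictMono (hs : IsNearId s s' b₀ β b₂) : StrictMono s :=
  strictMono_of_hasDerivAt_pos hs.hasDerivAt hs.deriv_pos

theorem surjective (hs : IsNearId s s' b₀ β b₂) : Function.Surjective s := by
  refine hs.continuous.surjective ?_ ?_
  · refine tendsto_atTop_mono (f := fun x => x + -b₀) (fun x => ?_)
      (tendsto_atTop_add_const_right _ _ tendsto_id)
    have := abs_le.mp (hs.abs_sub_le x); linarith [this.1]
  · refine tendsto_atBot_mono (f := fun x => x + b₀) (fun x => ?_)
      (tendsto_atBot_add_const_right _ _ tendsto_id)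
    have := abs_le.mp (hs.abs_sub_le x); linarith [this.2]

end IsNearId

/-- The difference of the squared Cauchy kernel and its pull-back under the shift `s`, at the point
`x - iε` below the real line and its image under the linearization of `s` at `x`. For `ε = 0` it is
`1 / h² - s'(x) s'(x + h) / (s(x + h) - s(x))²`. -/
noncomputable def weldKernel (s s' : ℝ → ℝ) (x ε h : ℝ) : ℂ :=
  1 / ((h : ℂ) + ε * I) ^ 2
    - s' x * s' (x + h) / (((s (x + h) - s x : ℝ) : ℂ) + (ε * s' x : ℝ) * I) ^ 2

theorem norm_sq_add_mul_I (h ε : ℝ) : ‖(h : ℂ) + ε * I‖ ^ 2 = h ^ 2 + ε ^ 2 := by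
  rw [← Complex.normSq_eq_norm_sq, Complex.normSq_add_mul_I]

/-- The kernel bound in terms of one number `e` measuring how far `s` is from its linearizations at
`x` and at `x + h`. It is used with `e = b₂ |h|` and with `e = 2 β`. -/
theorem IsNearId.norm_weldKernel_le {s s' : ℝ → ℝ} {b₀ β b₂ : ℝ} (hs : IsNearId s s' b₀ β b₂)
    {x ε h e : ℝ} (hε : 0 ≤ ε) (h0 : h ≠ 0 ∨ ε ≠ 0) (e0 : |s' (x + h) - s' x| ≤ e)
    (e1 : |s (x + h) - s x - s' x * h| ≤ e * |h|)
    (e2 : |s (x + h) - s x - s' (x + h) * h| ≤ e * |h|) :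
    ‖weldKernel s s' x ε h‖
      ≤ (1 + β) / (1 - β) ^ 2 * e * (2 * h ^ 2 + 2 * ε * |h| + ε ^ 2) / (h ^ 2 + ε ^ 2) ^ 2 := by
  have hD1 := hs.abs_image_sub_le x h
  have hD2 := hs.le_abs_image_sub x h
  have hs0 := hs.deriv_ge x
  have hs0' := hs.deriv_le x
  have hs1' := hs.deriv_le (x + h)
  have hs1 := hs.deriv_ge (x + h)
  have hβ := hs.lt_one
  have hβ0 := hs.beta_nonneg
  unfold weldKernel
  generalize s (x + h) - s x = D at *
  generalize s' x = p at *
  generalize s' (x + h) = q at *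
  have he : 0 ≤ e := (abs_nonneg _).trans e0
  have hpos : 0 < h ^ 2 + ε ^ 2 := by
    rcases h0 with h0 | h0 <;> positivity
  have hA : ‖(h : ℂ) + ε * I‖ ^ 2 = h ^ 2 + ε ^ 2 := norm_sq_add_mul_I h ε
  have hB : (1 - β) ^ 2 * (h ^ 2 + ε ^ 2) ≤ ‖(D : ℂ) + (ε * p : ℝ) * I‖ ^ 2 := by
    rw [norm_sq_add_mul_I]
    have h1 : ((1 - β) * |h|) ^ 2 ≤ |D| ^ 2 :=
      pow_le_pow_left₀ (mul_nonneg (by linarith) (abs_nonneg _)) hD2 2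
    have h2 : (1 - β) ^ 2 ≤ p ^ 2 := pow_le_pow_left₀ (by linarith) hs0 2
    rw [mul_pow, sq_abs, sq_abs] at h1
    nlinarith [mul_le_mul_of_nonneg_left h2 (sq_nonneg ε)]
  have hBpos : 0 < (1 - β) ^ 2 * (h ^ 2 + ε ^ 2) := by
    have : 0 < 1 - β := by linarith
    positivity
  have hA0 : (h : ℂ) + ε * I ≠ 0 := by
    intro h; rw [h] at hA; simp at hA; linarith
  have hB0 : (D : ℂ) + (ε * p : ℝ) * I ≠ 0 := by
    intro h; rw [h] at hB; simp at hB; linarith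
  have hN : 1 / ((h : ℂ) + ε * I) ^ 2 - p * q / ((D : ℂ) + (ε * p : ℝ) * I) ^ 2
      = (((D * (D - p * h) + p * h * (D - q * h) + ε ^ 2 * p * (q - p) : ℝ) : ℂ)
          + (2 * ε * p * (D - q * h) : ℝ) * I)
        / (((h : ℂ) + ε * I) ^ 2 * ((D : ℂ) + (ε * p : ℝ) * I) ^ 2) := by
    rw [div_sub_div _ _ (pow_ne_zero 2 hA0) (pow_ne_zero 2 hB0)]
    congr 1
    push_cast
    linear_combination (ε ^ 2 * p ^ 2 - ε ^ 2 * p * q) * I_sq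
  rw [hN, norm_div, norm_mul, norm_pow, norm_pow, hA]
  have hnum : ‖((D * (D - p * h) + p * h * (D - q * h) + ε ^ 2 * p * (q - p) : ℝ) : ℂ)
          + (2 * ε * p * (D - q * h) : ℝ) * I‖ ≤ (1 + β) * e * (2 * h ^ 2 + 2 * ε * |h| + ε ^ 2) := by
    refine (norm_add_le _ _).trans ?_
    rw [norm_mul, Complex.norm_I, mul_one, Complex.norm_real, Complex.norm_real,
      Real.norm_eq_abs, Real.norm_eq_abs]
    have hp0 : 0 ≤ p := by linarith
    have hh : |h| * |h| = h ^ 2 := by rw [← sq, sq_abs]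
    have t1 : |D * (D - p * h)| ≤ (1 + β) * e * h ^ 2 := by
      rw [abs_mul]
      calc |D| * |D - p * h| ≤ ((1 + β) * |h|) * (e * |h|) := by gcongr
        _ = _ := by rw [← hh]; ring
    have t2 : |p * h * (D - q * h)| ≤ (1 + β) * e * h ^ 2 := by
      rw [abs_mul, abs_mul, abs_of_nonneg hp0]
      calc p * |h| * |D - q * h| ≤ ((1 + β) * |h|) * (e * |h|) := by gcongr
        _ = _ := by rw [← hh]; ring
    have t3 : |ε ^ 2 * p * (q - p)| ≤ (1 + β) * e * ε ^ 2 := by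
      rw [abs_mul, abs_mul, abs_of_nonneg hp0, abs_of_nonneg (sq_nonneg ε)]
      calc ε ^ 2 * p * |q - p| ≤ ε ^ 2 * (1 + β) * e := by gcongr
        _ = _ := by ring
    have t4 : |2 * ε * p * (D - q * h)| ≤ (1 + β) * e * (2 * ε * |h|) := by
      rw [abs_mul, abs_of_nonneg (by positivity : 0 ≤ 2 * ε * p)]
      calc 2 * ε * p * |D - q * h| ≤ 2 * ε * (1 + β) * (e * |h|) := by gcongr
        _ = _ := by ring
    have t5 := abs_add_three (D * (D - p * h)) (p * h * (D - q * h)) (ε ^ 2 * p * (q - p))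
    nlinarith
  have hnn : 0 ≤ (1 + β) * e * (2 * h ^ 2 + 2 * ε * |h| + ε ^ 2) := by positivity
  refine (div_le_div₀ hnn hnum (by positivity)
    (mul_le_mul_of_nonneg_left hB hpos.le)).trans (le_of_eq ?_)
  have : 1 - β ≠ 0 := by linarith
  field_simp

/-- Uniform bound of the kernel, by the two cases of `norm_weldKernel_le`. -/
theorem IsNearId.norm_weldKernel_le_min {s s' : ℝ → ℝ} {b₀ β b₂ : ℝ} (hs : IsNearId s s' b₀ β b₂)
    {x ε h : ℝ} (hε : 0 ≤ ε) (h0 : h ≠ 0 ∨ ε ≠ 0) :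
    ‖weldKernel s s' x ε h‖
      ≤ 3 * (1 + β) / (1 - β) ^ 2 * (b₂ + 2 * β) * (min |h| 1 / (h ^ 2 + ε ^ 2)) := by
  have hβ := hs.beta_nonneg
  have hb := hs.b₂_nonneg
  have hpos : 0 < h ^ 2 + ε ^ 2 := by
    rcases h0 with h0 | h0 <;> positivity
  have key : ∀ e : ℝ, 0 ≤ e → e ≤ (b₂ + 2 * β) * min |h| 1 →
      (1 + β) / (1 - β) ^ 2 * e * (2 * h ^ 2 + 2 * ε * |h| + ε ^ 2) / (h ^ 2 + ε ^ 2) ^ 2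
      ≤ 3 * (1 + β) / (1 - β) ^ 2 * (b₂ + 2 * β) * (min |h| 1 / (h ^ 2 + ε ^ 2)) := by
    intro e he0 he
    have h1 : 2 * h ^ 2 + 2 * ε * |h| + ε ^ 2 ≤ 3 * (h ^ 2 + ε ^ 2) := by
      nlinarith [sq_nonneg (ε - |h|), sq_abs h, sq_nonneg ε]
    have hc : 0 ≤ (1 + β) / (1 - β) ^ 2 := by positivity
    calc _ ≤ (1 + β) / (1 - β) ^ 2 * ((b₂ + 2 * β) * min |h| 1) * (3 * (h ^ 2 + ε ^ 2))
          / (h ^ 2 + ε ^ 2) ^ 2 := by gcongr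
      _ = _ := by field_simp
  rcases le_total |h| 1 with hh | hh
  · refine (hs.norm_weldKernel_le (e := b₂ * |h|) hε h0 ?_ (hs.taylor_left x h)
      (hs.taylor_right x h)).trans (key _ (by positivity) ?_)
    · simpa using hs.lipschitz (x + h) x
    · rw [min_eq_left hh]; gcongr; linarith
  · refine (hs.norm_weldKernel_le (e := 2 * β) hε h0 (hs.abs_deriv_sub_deriv_le _ _)
      (hs.abs_sub_sub_deriv_le _ _ _) (hs.abs_sub_sub_deriv_le _ _ _)).trans (key _ (by positivity) ?_)
    rw [min_eq_right hh]; linarith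

/-! ### Representation of the derivative and Hölder continuity -/

/-- Representation of the derivative of the lower function at `x - iε` by boundary differences of
the shift and of the upper function. -/
theorem deriv_lower_eq_integral {s s' : ℝ → ℝ} {b₀ β b₂ : ℝ} (hs : IsNearId s s' b₀ β b₂)
    {U V : ℂ → ℂ} (hU : IsUpperBdd U) (hV : IsLowerBdd V)
    (hj : ∀ x : ℝ, V x = (s x - x : ℝ) + U (s x)) (x : ℝ) {ε : ℝ} (hε : 0 < ε) :
    -(2 * Real.pi * I * deriv V ((x : ℂ) - ε * I)) =
      ∫ h : ℝ, (((s (x + h) - s x - h : ℝ) : ℂ) / ((h : ℂ) + ε * I) ^ 2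
        + (U (s (x + h)) - U (s x)) * weldKernel s s' x ε h) := by
  obtain ⟨A, hA⟩ := hU.bdd
  have hUc := hU.continuous_real
  have hsc := hs.continuous
  -- the Cauchy integral of `V`
  have h1 := hV.integral_div_sq (z := (x : ℂ) - ε * I) (by simpa using hε)
  rw [← integral_add_left_eq_self _ x] at h1
  have hVb : ∀ t : ℝ, ‖V t‖ ≤ b₀ + A := fun t => by
    rw [hj t]
    refine (norm_add_le _ _).trans (add_le_add ?_ (hA _ (by simp)))
    rw [Complex.norm_real]; exact hs.abs_sub_le t
  have i1 : Integrable fun h : ℝ => V ((x + h : ℝ) : ℂ) / (((x + h : ℝ) : ℂ) - ((x : ℂ) - ε * I)) ^ 2 :=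
    (integrable_div_sub_sq hV.continuous_real hVb (by simpa using hε.ne')).comp_add_left x
  -- constants integrate to zero
  have h2 := (IsUpperBdd.const (V x)).integral_div_sq_eq_zero (w := -(ε * I)) (by simpa using hε)
  have i2 : Integrable fun h : ℝ => V x / ((h : ℂ) - (-(ε * I))) ^ 2 :=
    integrable_div_sub_sq continuous_const (fun _ => le_rfl) (by simpa using hε.ne')
  -- the Cauchy integral of `U` below the real line, pulled back by `s`
  have hp := hs.deriv_pos x
  set w : ℂ := (s x : ℂ) - (ε * s' x : ℝ) * I with hw
  have hwim : w.im < 0 := by simp only [hw]; simpa using mul_pos hε hp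
  have hsub : IsUpperBdd fun z => U z - U (s x) :=
    ⟨hU.cont.sub continuousOn_const, hU.diff.sub (differentiableOn_const _), A + A, fun z hz =>
      (norm_sub_le _ _).trans (add_le_add (hA z hz) (hA _ (by simp)))⟩
  have h3 := hsub.integral_div_sq_eq_zero hwim
  have i3 : Integrable fun y : ℝ => (U y - U (s x)) / ((y : ℂ) - w) ^ 2 :=
    integrable_div_sub_sq hsub.continuous_real (fun y => (norm_sub_le _ _).trans
      (add_le_add (hA y (by simp)) (hA _ (by simp)))) hwim.ne
  have hder : ∀ h ∈ Set.univ, HasDerivWithinAt (fun h => s (x + h)) (s' (x + h)) Set.univ h :=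
    fun h _ => ((hs.hasDerivAt (x + h)).comp_const_add x h).hasDerivWithinAt
  have hinj : Set.InjOn (fun h => s (x + h)) Set.univ :=
    (hs.strictMono.injective.comp (add_right_injective x)).injOn
  have himg : (fun h => s (x + h)) '' Set.univ = Set.univ := by
    rw [Set.image_univ]
    exact (hs.surjective.comp (add_left_surjective x)).range_eq
  have h4 := integral_image_eq_integral_abs_deriv_smul MeasurableSet.univ hder hinj
    fun y : ℝ => (U y - U (s x)) / ((y : ℂ) - w) ^ 2
  have i4 := (integrableOn_image_iff_integrableOn_abs_deriv_smul MeasurableSet.univ hder hinj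
    fun y : ℝ => (U y - U (s x)) / ((y : ℂ) - w) ^ 2).mp (by rw [himg]; exact i3.integrableOn)
  rw [himg, setIntegral_univ, setIntegral_univ, h3] at h4
  rw [integrableOn_univ] at i4
  have e : ∀ h : ℝ, (((s (x + h) - s x - h : ℝ) : ℂ) / ((h : ℂ) + ε * I) ^ 2
        + (U (s (x + h)) - U (s x)) * weldKernel s s' x ε h)
      = V ((x + h : ℝ) : ℂ) / (((x + h : ℝ) : ℂ) - ((x : ℂ) - ε * I)) ^ 2
        - V x / ((h : ℂ) - (-(ε * I))) ^ 2
        - s' x * (|s' (x + h)| • ((U (s (x + h)) - U (s x)) / ((s (x + h) : ℂ) - w) ^ 2)) := by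
    intro h
    have e1 : ((x + h : ℝ) : ℂ) - ((x : ℂ) - ε * I) = h + ε * I := by push_cast; ring
    have e2 : (s (x + h) : ℂ) - w = ((s (x + h) - s x : ℝ) : ℂ) + (ε * s' x : ℝ) * I := by
      rw [hw]; push_cast; ring
    rw [e1, e2, sub_neg_eq_add, hj, hj x, abs_of_pos (hs.deriv_pos _), weldKernel, real_smul]
    push_cast
    ring
  simp_rw [e]
  have i12 : Integrable fun h : ℝ =>
      V ((x + h : ℝ) : ℂ) / (((x + h : ℝ) : ℂ) - ((x : ℂ) - ε * I)) ^ 2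
        - V x / ((h : ℂ) - (-(ε * I))) ^ 2 := i1.sub i2
  rw [integral_sub i12 (i4.const_mul _), integral_sub i1 i2, integral_const_mul, ← h4, h2,
    h1]
  simp

/-- An even weight that is `|h|^(-1/2)` near `0` and `|h|^(-3/2)` at infinity. -/
noncomputable def weight (h : ℝ) : ℝ := √|h| * (min |h| 1 / h ^ 2)

theorem weight_of_le_one {h : ℝ} (h0 : 0 < h) (h1 : h ≤ 1) : weight h = h ^ (-(1 / 2) : ℝ) := by
  have := Real.sqrt_pos.mpr h0
  rw [weight, abs_of_pos h0, min_eq_left h1, Real.rpow_neg h0.le, ← Real.sqrt_eq_rpow]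
  have := Real.sq_sqrt h0.le
  field_simp
  linarith

theorem sqrt_div_sq {h : ℝ} (h0 : 0 < h) : √h / h ^ 2 = h ^ (-(3 / 2) : ℝ) := by
  rw [Real.sqrt_eq_rpow, ← Real.rpow_natCast, ← Real.rpow_sub h0]
  norm_num

theorem weight_of_one_le {h : ℝ} (h1 : 1 ≤ h) : weight h = h ^ (-(3 / 2) : ℝ) := by
  have h0 : 0 < h := by linarith
  rw [weight, abs_of_pos h0, min_eq_right h1, ← sqrt_div_sq h0]
  ring

theorem integrable_of_even_of_integrableOn {f : ℝ → ℝ} (he : ∀ x, f (-x) = f x)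
    (hf : IntegrableOn f (Set.Ioi 0)) : Integrable f := by
  have h2 : IntegrableOn f (Set.Iic 0) := by
    rw [← Measure.map_neg_eq_self (volume : Measure ℝ)]
    have m : MeasurableEmbedding fun x : ℝ => -x := (Homeomorph.neg ℝ).measurableEmbedding
    rw [m.integrableOn_map_iff]
    have : f ∘ (fun x => -x) = f := funext he
    rw [this]
    simpa using (integrableOn_Ici_iff_integrableOn_Ioi).mpr hf
  have := h2.union hf
  rwa [Set.Iic_union_Ioi, integrableOn_univ] at this

theorem integrable_weight : Integrable weight := by
  refine integrable_of_even_of_integrableOn (fun x => by simp [weight]) ?_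
  rw [← Set.Ioc_union_Ioi_eq_Ioi zero_le_one]
  refine IntegrableOn.union ?_ ?_
  · have h := (intervalIntegral.intervalIntegrable_rpow' (a := 0) (b := 1) (r := -(1 / 2))
      (by norm_num)).1
    exact h.congr_fun (fun x hx => (weight_of_le_one hx.1 hx.2).symm) measurableSet_Ioc
  · exact (integrableOn_Ioi_rpow_of_lt (a := -(3 / 2)) (by norm_num) one_pos).congr_fun
      (fun x hx => (weight_of_one_le (le_of_lt hx)).symm) measurableSet_Ioi

theorem min_abs_one_le_sqrt (h : ℝ) : min |h| 1 ≤ √|h| := by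
  rcases le_total |h| 1 with hh | hh
  · rw [min_eq_left hh]
    exact Real.le_sqrt_of_sq_le (by nlinarith [abs_nonneg h])
  · rw [min_eq_right hh]
    exact Real.one_le_sqrt.mpr hh

theorem integrable_sqrt_div : Integrable fun h : ℝ => √|h| / (h ^ 2 + 1) := by
  refine integrable_weight.mono' ?_ ?_
  · exact (Continuous.div (by fun_prop) (by fun_prop) fun x => by positivity).aestronglyMeasurable
  · refine (Measure.ae_ne volume 0).mono fun h h0 => ?_
    rw [Real.norm_of_nonneg (by positivity), weight, div_eq_mul_inv]
    gcongr
    rw [inv_eq_one_div, div_le_div_iff₀ (by positivity) (by positivity)]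
    have hh := sq_abs h
    have := abs_pos.mpr h0
    rcases le_total |h| 1 with hh' | hh'
    · rw [min_eq_left hh']; nlinarith
    · rw [min_eq_right hh']; nlinarith

theorem integral_sqrt_div (ε : ℝ) (hε : 0 < ε) :
    Integrable (fun h : ℝ => √|h| / (h ^ 2 + ε ^ 2)) ∧
    ∫ h : ℝ, √|h| / (h ^ 2 + ε ^ 2) = (∫ h : ℝ, √|h| / (h ^ 2 + 1)) / √ε := by
  have e : (fun h : ℝ => √|h| / (h ^ 2 + ε ^ 2))
      = fun h => (√ε / ε ^ 2) * (√|h / ε| / ((h / ε) ^ 2 + 1)) := by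
    ext h
    rw [abs_div, abs_of_pos hε, Real.sqrt_div (abs_nonneg h)]
    have := Real.sqrt_pos.mpr hε
    field_simp
  rw [e]
  refine ⟨(integrable_sqrt_div.comp_div hε.ne').const_mul _, ?_⟩
  rw [integral_const_mul, Measure.integral_comp_div (fun h => √|h| / (h ^ 2 + 1)), abs_of_pos hε,
    smul_eq_mul]
  have := Real.sqrt_pos.mpr hε
  have h2 := Real.sq_sqrt hε.le
  field_simp
  rw [h2]

section Regularity

variable {s s' : ℝ → ℝ} {b₀ β b₂ : ℝ} {U V : ℂ → ℂ}

theorem IsNearId.abs_shift_sub_le_sqrt (hs : IsNearId s s' b₀ β b₂) (x h : ℝ) :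
    |s (x + h) - s x - h| ≤ (β + 2 * b₀) * √|h| := by
  have h1 := hs.abs_shift_sub_le x h
  have h2 := hs.abs_shift_sub_le' x h
  have hβ := hs.beta_nonneg
  have hb := hs.b₀_nonneg
  refine le_trans ?_ (mul_le_mul_of_nonneg_left (min_abs_one_le_sqrt h) (by positivity))
  rcases le_total |h| 1 with hh | hh
  · rw [min_eq_left hh]; nlinarith [abs_nonneg h]
  · rw [min_eq_right hh]; nlinarith

/-- The kernel bound, uniform in the base point and in the height, in terms of one constant. -/
theorem IsNearId.exists_norm_weldKernel_le (hs : IsNearId s s' b₀ β b₂) :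
    ∃ C : ℝ, 0 ≤ C ∧ ∀ x ε h : ℝ, 0 ≤ ε → (h ≠ 0 ∨ ε ≠ 0) →
      ‖weldKernel s s' x ε h‖ ≤ C * (min |h| 1 / (h ^ 2 + ε ^ 2)) := by
  have hβ := hs.beta_nonneg
  have hb := hs.b₂_nonneg
  exact ⟨3 * (1 + β) / (1 - β) ^ 2 * (b₂ + 2 * β), by positivity,
    fun x ε h hε h0 => hs.norm_weldKernel_le_min hε h0⟩

/-- The derivative of the lower function grows at most like `ε^(-1/2)` at the real line. -/
theorem exists_norm_deriv_le_div_sqrt (hs : IsNearId s s' b₀ β b₂) (hU : IsUpperBdd U)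
    (hV : IsLowerBdd V) (hj : ∀ x : ℝ, V x = (s x - x : ℝ) + U (s x)) :
    ∃ M : ℝ, 0 ≤ M ∧ ∀ z : ℂ, z.im < 0 → ‖deriv V z‖ ≤ M / √(-z.im) := by
  obtain ⟨A, hA⟩ := hU.bdd
  have hA0 : 0 ≤ A := (norm_nonneg _).trans (hA 0 (by simp))
  obtain ⟨C, hC0, hC⟩ := hs.exists_norm_weldKernel_le
  have hβ := hs.beta_nonneg
  have hb := hs.b₀_nonneg
  set J := ∫ h : ℝ, √|h| / (h ^ 2 + 1)
  have hJ : 0 ≤ J := integral_nonneg fun h => by positivity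
  set N := β + 2 * b₀ + 2 * A * C
  refine ⟨N * J / (2 * Real.pi), by positivity, fun z hz => ?_⟩
  have hε : 0 < -z.im := by linarith
  have h := deriv_lower_eq_integral hs hU hV hj z.re hε
  have hz' : (z.re : ℂ) - (-z.im : ℝ) * I = z := by
    apply Complex.ext <;> simp
  rw [hz'] at h
  obtain ⟨i1, i2⟩ := integral_sqrt_div (-z.im) hε
  generalize -z.im = ε at *
  have hb : ‖-(2 * Real.pi * I * deriv V z)‖ ≤ ∫ h : ℝ, N * (√|h| / (h ^ 2 + ε ^ 2)) := by
    rw [h]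
    refine norm_integral_le_of_norm_le (i1.const_mul N) (Eventually.of_forall fun t => ?_)
    have hp : 0 < t ^ 2 + ε ^ 2 := by positivity
    refine (norm_add_le _ _).trans ?_
    have t1 : ‖((s (z.re + t) - s z.re - t : ℝ) : ℂ) / ((t : ℂ) + ε * I) ^ 2‖
        ≤ (β + 2 * b₀) * (√|t| / (t ^ 2 + ε ^ 2)) := by
      rw [norm_div, norm_pow, norm_sq_add_mul_I, Complex.norm_real, ← mul_div_assoc]
      gcongr
      exact hs.abs_shift_sub_le_sqrt _ _
    have t2 : ‖(U (s (z.re + t)) - U (s z.re)) * weldKernel s s' z.re ε t‖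
        ≤ (2 * A) * (C * (√|t| / (t ^ 2 + ε ^ 2))) := by
      rw [norm_mul]
      have h1 : ‖U (s (z.re + t)) - U (s z.re)‖ ≤ 2 * A := by
        refine (norm_sub_le _ _).trans ?_
        linarith [hA (s (z.re + t)) (by simp), hA (s z.re) (by simp)]
      have h2 := hC z.re ε t hε.le (Or.inr hε.ne')
      have h3 : min |t| 1 / (t ^ 2 + ε ^ 2) ≤ √|t| / (t ^ 2 + ε ^ 2) := by
        gcongr
        exact min_abs_one_le_sqrt t
      exact mul_le_mul h1 (h2.trans (by gcongr)) (norm_nonneg _) (by positivity)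
    calc _ ≤ _ := add_le_add t1 t2
      _ = _ := by simp only [N]; ring
  rw [integral_const_mul, i2, norm_neg, norm_mul, norm_mul, norm_mul, Complex.norm_I,
    Complex.norm_real, Real.norm_of_nonneg Real.pi_pos.le] at hb
  have hpi := Real.pi_pos
  rw [Complex.norm_ofNat] at hb
  have hsq := Real.sqrt_pos.mpr hε
  rw [le_div_iff₀ hsq, le_div_iff₀ (by positivity)]
  rw [mul_div_assoc', le_div_iff₀ hsq] at hb
  linarith

/-- Hölder continuity of the upper function transported by `s`: the lower function has it by
`IsLowerBdd.norm_sub_le_sqrt`, and the two differ by the shift. -/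
theorem exists_norm_comp_sub_le_sqrt (hs : IsNearId s s' b₀ β b₂) (hU : IsUpperBdd U)
    (hV : IsLowerBdd V) (hj : ∀ x : ℝ, V x = (s x - x : ℝ) + U (s x)) :
    ∃ H : ℝ, 0 ≤ H ∧ ∀ x h : ℝ, ‖U (s (x + h)) - U (s x)‖ ≤ H * √|h| := by
  obtain ⟨M, hM0, hM⟩ := exists_norm_deriv_le_div_sqrt hs hU hV hj
  have hβ := hs.beta_nonneg
  have hb := hs.b₀_nonneg
  refine ⟨5 * M + (β + 2 * b₀), by positivity, fun x h => ?_⟩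
  have h1 := hV.norm_sub_le_sqrt hM0 hM (x + h) x
  have h2 := hs.abs_shift_sub_le_sqrt x h
  rw [hj, hj, add_sub_cancel_left] at h1
  have e : U (s (x + h)) - U (s x) = (((s (x + h) - (x + h) : ℝ) : ℂ) + U (s (x + h))
      - (((s x - x : ℝ) : ℂ) + U (s x))) - ((s (x + h) - s x - h : ℝ) : ℂ) := by
    push_cast; ring
  rw [e]
  refine (norm_sub_le _ _).trans ?_
  rw [Complex.norm_real (s (x + h) - s x - h), Real.norm_eq_abs]
  linarith

end Regularity

/-! ### Continuous extension of the derivative to the real line -/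

theorem isUpperBdd_inv_add_I : IsUpperBdd fun z => 1 / (z + I) := by
  have hne : ∀ z : ℂ, 0 ≤ z.im → z + I ≠ 0 := by
    intro z hz h; have := congrArg Complex.im h; simp at this; linarith
  refine ⟨continuousOn_const.div (by fun_prop) hne,
    (differentiableOn_const _).div (by fun_prop) fun z hz => hne z (le_of_lt hz), 1, fun z hz => ?_⟩
  rw [norm_div, norm_one, div_le_one (norm_pos_iff.mpr (hne z hz))]
  refine le_trans ?_ (Complex.abs_im_le_norm _)
  rw [le_abs]; left; simpa using hz

/-- The Cauchy integral of the odd profile `h / (1 + h²)`, by partial fractions. -/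
theorem integral_odd_profile {ε : ℝ} (hε : 0 < ε) :
    Integrable (fun h : ℝ => ((h / (1 + h ^ 2) : ℝ) : ℂ) / ((h : ℂ) + ε * I) ^ 2) ∧
    ∫ h : ℝ, ((h / (1 + h ^ 2) : ℝ) : ℂ) / ((h : ℂ) + ε * I) ^ 2 = -(Real.pi * I) / (1 + ε) ^ 2 := by
  have hL : IsLowerBdd fun z => 1 / (z - I) := by
    have h := isUpperBdd_inv_add_I
    have e : (fun z : ℂ => 1 / (-z - I)) = fun z => -(1 / (z + I)) := by
      ext z; rw [← one_div_neg_eq_neg_one_div]; congr 1; ring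
    show IsUpperBdd fun z => 1 / (-z - I)
    rw [e]
    obtain ⟨M, hM⟩ := h.bdd
    exact ⟨h.cont.neg, h.diff.neg, M, fun z hz => by rw [norm_neg]; exact hM z hz⟩
  have h1 := isUpperBdd_inv_add_I.integral_div_sq_eq_zero (w := -(ε * I)) (by simpa using hε)
  have h2 := hL.integral_div_sq (z := -(ε * I)) (by simpa using hε)
  obtain ⟨M, hM⟩ := isUpperBdd_inv_add_I.bdd
  obtain ⟨M', hM'⟩ := id hL.bdd
  have i1 : Integrable fun h : ℝ => 1 / ((h : ℂ) + I) / ((h : ℂ) - (-(ε * I))) ^ 2 :=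
    integrable_div_sub_sq isUpperBdd_inv_add_I.continuous_real (N := M) (fun x => hM x (by simp))
      (by simpa using hε.ne')
  have i2 : Integrable fun h : ℝ => 1 / ((h : ℂ) - I) / ((h : ℂ) - (-(ε * I))) ^ 2 :=
    integrable_div_sub_sq hL.continuous_real (N := M') (fun x => by simpa using hM' (-x) (by simp))
      (by simpa using hε.ne')
  have e : (fun h : ℝ => ((h / (1 + h ^ 2) : ℝ) : ℂ) / ((h : ℂ) + ε * I) ^ 2)
      = fun h : ℝ => (1 / 2 : ℂ) * (1 / ((h : ℂ) + I) / ((h : ℂ) - (-(ε * I))) ^ 2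
        + 1 / ((h : ℂ) - I) / ((h : ℂ) - (-(ε * I))) ^ 2) := by
    ext h
    have n1 : (h : ℂ) + I ≠ 0 := by intro h; have := congrArg Complex.im h; simp at this
    have n2 : (h : ℂ) - I ≠ 0 := by intro h; have := congrArg Complex.im h; simp at this
    have n3 : (1 + (h : ℂ) ^ 2) = (h + I) * (h - I) := by linear_combination I_sq
    rw [sub_neg_eq_add, ← add_div, ← mul_div_assoc]
    congr 1
    push_cast
    rw [n3, div_add_div _ _ n1 n2, mul_div_assoc']
    congr 1
    ring
  rw [e]
  refine ⟨(i1.add i2).const_mul _, ?_⟩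
  rw [integral_const_mul, integral_add i1 i2, h1, h2]
  have hne : -((ε : ℂ) * I) - I ≠ 0 := by
    intro h; have := congrArg Complex.im h; simp at this; linarith
  have hd : HasDerivAt (fun z : ℂ => 1 / (z - I)) (-1 / (-((ε : ℂ) * I) - I) ^ 2) (-((ε : ℂ) * I)) := by
    have := ((hasDerivAt_id (-((ε : ℂ) * I))).sub_const I).fun_inv hne
    simpa [one_div] using this
  rw [hd.deriv]
  have e2 : (-((ε : ℂ) * I) - I) ^ 2 = -(1 + ε) ^ 2 := by linear_combination (1 + (ε : ℂ)) ^ 2 * I_sq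
  rw [e2]
  have : (1 + (ε : ℂ)) ≠ 0 := by
    intro h; have := congrArg Complex.re h; simp at this; linarith
  field_simp
  ring

/-- The shift difference `s (x + h) - s x - h` minus an odd profile with the same first-order
behaviour at `h = 0`. -/
noncomputable def shiftRemainder (s s' : ℝ → ℝ) (x h : ℝ) : ℝ :=
  s (x + h) - s x - h - (s' x - 1) * (h / (1 + h ^ 2))

/-- The integrand representing the derivative of the lower function at `x - iε`, after the odd
profile has been split off. -/
noncomputable def derivIntegrand (s s' : ℝ → ℝ) (U : ℂ → ℂ) (x ε h : ℝ) : ℂ :=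
  (shiftRemainder s s' x h : ℂ) / ((h : ℂ) + ε * I) ^ 2
    + (U (s (x + h)) - U (s x)) * weldKernel s s' x ε h

/-- The derivative of the boundary values of the lower function. -/
noncomputable def boundaryDeriv (s s' : ℝ → ℝ) (U : ℂ → ℂ) (x : ℝ) : ℂ :=
  -(2 * Real.pi * I)⁻¹ * ((∫ h : ℝ, derivIntegrand s s' U x 0 h) - Real.pi * I * (s' x - 1 : ℝ))

section Regularity

variable {s s' : ℝ → ℝ} {b₀ β b₂ : ℝ} {U V : ℂ → ℂ}

theorem IsNearId.abs_shiftRemainder_le (hs : IsNearId s s' b₀ β b₂) (x h : ℝ) :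
    |shiftRemainder s s' x h| ≤ 2 * (b₂ + β + 2 * b₀) * (h ^ 2 / (1 + h ^ 2)) := by
  have hβ := hs.beta_nonneg
  have hb := hs.b₀_nonneg
  have hb2 := hs.b₂_nonneg
  have h1 := hs.taylor_left x h
  have h2 := hs.abs_shift_sub_le' x h
  have h3 := hs.abs_deriv_sub_le x
  have hp : 0 < 1 + h ^ 2 := by positivity
  have hh : |h| * |h| = h ^ 2 := by rw [← sq, sq_abs]
  rcases le_total |h| 1 with hle | hle
  · have e : shiftRemainder s s' x h
        = (s (x + h) - s x - s' x * h) + (s' x - 1) * (h * (h ^ 2 / (1 + h ^ 2))) := by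
      unfold shiftRemainder; field_simp; ring
    have e2 : h ^ 2 ≤ 2 * (h ^ 2 / (1 + h ^ 2)) := by
      have h1 : h ^ 2 ≤ 1 := by rw [← sq_abs]; exact pow_le_one₀ (abs_nonneg h) hle
      rw [mul_div_assoc', le_div_iff₀ hp]
      nlinarith [sq_nonneg h]
    have q0 : 0 ≤ h ^ 2 / (1 + h ^ 2) := by positivity
    rw [e]
    refine (abs_add_le _ _).trans ?_
    rw [abs_mul, abs_mul, abs_of_nonneg q0]
    have t1 : b₂ * |h| * |h| ≤ b₂ * (2 * (h ^ 2 / (1 + h ^ 2))) := by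
      rw [mul_assoc, hh]; gcongr
    have t2 : |s' x - 1| * (|h| * (h ^ 2 / (1 + h ^ 2))) ≤ β * (1 * (h ^ 2 / (1 + h ^ 2))) := by
      gcongr
    nlinarith
  · have q1 : 1 ≤ 2 * (h ^ 2 / (1 + h ^ 2)) := by
      rw [mul_div_assoc', le_div_iff₀ hp]
      nlinarith [abs_nonneg h, sq_nonneg h, sq_abs h]
    have q2 : |h / (1 + h ^ 2)| ≤ 1 := by
      rw [abs_div, abs_of_pos hp, div_le_one hp]
      nlinarith [abs_nonneg h, sq_nonneg h, sq_abs h]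
    unfold shiftRemainder
    refine (abs_sub _ _).trans ?_
    rw [abs_mul]
    have t2 : |s' x - 1| * |h / (1 + h ^ 2)| ≤ β * 1 := by gcongr
    nlinarith

theorem IsNearId.measurable_derivIntegrand (hs : IsNearId s s' b₀ β b₂) (hU : IsUpperBdd U)
    (x ε : ℝ) : Measurable (derivIntegrand s s' U x ε) := by
  have h1 := hs.continuous.measurable
  have h2 := hs.continuous_deriv.measurable
  have h3 : Measurable fun t : ℝ => U (s (x + t)) :=
    (hU.continuous_real.comp (hs.continuous.comp (by fun_prop : Continuous fun t : ℝ => x + t))).measurable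
  have h4 : Measurable fun t : ℝ => (s' (x + t) : ℂ) := by
    exact Complex.measurable_ofReal.comp (h2.comp (measurable_const_add x))
  have h5 : Measurable fun t : ℝ => ((s (x + t) - s x : ℝ) : ℂ) := by
    exact Complex.measurable_ofReal.comp ((h1.comp (measurable_const_add x)).sub_const _)
  have h6 : Measurable fun t : ℝ => (shiftRemainder s s' x t : ℂ) := by
    refine Complex.measurable_ofReal.comp ?_
    unfold shiftRemainder
    fun_prop
  have h7 : Measurable fun t : ℝ => (t : ℂ) := Complex.measurable_ofReal
  unfold derivIntegrand weldKernel
  exact (h6.div ((h7.add_const _).pow_const 2)).add ((h3.sub_const _).mul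
    ((measurable_const.div ((h7.add_const _).pow_const 2)).sub
      ((h4.const_mul _).div ((h5.add_const _).pow_const 2))))

/-- An integrable bound of the integrand, uniform in the base point and in the height. -/
theorem exists_norm_derivIntegrand_le (hs : IsNearId s s' b₀ β b₂) (hU : IsUpperBdd U)
    (hV : IsLowerBdd V) (hj : ∀ x : ℝ, V x = (s x - x : ℝ) + U (s x)) :
    ∃ B : ℝ → ℝ, Integrable B ∧ ∀ x ε h : ℝ, 0 ≤ ε → h ≠ 0 →
      ‖derivIntegrand s s' U x ε h‖ ≤ B h := by
  obtain ⟨H, hH0, hH⟩ := exists_norm_comp_sub_le_sqrt hs hU hV hj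
  obtain ⟨C, hC0, hC⟩ := hs.exists_norm_weldKernel_le
  have hβ := hs.beta_nonneg
  have hb := hs.b₀_nonneg
  have hb2 := hs.b₂_nonneg
  refine ⟨fun h => 2 * (b₂ + β + 2 * b₀) * (1 + h ^ 2)⁻¹ + H * C * weight h,
    (integrable_inv_one_add_sq.const_mul _).add (integrable_weight.const_mul _),
    fun x ε h hε h0 => ?_⟩
  have hh : 0 < h ^ 2 := by positivity
  refine (norm_add_le _ _).trans (add_le_add ?_ ?_)
  · rw [norm_div, norm_pow, norm_sq_add_mul_I, Complex.norm_real, Real.norm_eq_abs,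
      div_le_iff₀ (by positivity)]
    have h1 : h ^ 2 / (1 + h ^ 2) ≤ (1 + h ^ 2)⁻¹ * (h ^ 2 + ε ^ 2) := by
      rw [div_eq_inv_mul]
      gcongr
      nlinarith [sq_nonneg ε]
    calc _ ≤ _ := hs.abs_shiftRemainder_le x h
      _ ≤ 2 * (b₂ + β + 2 * b₀) * ((1 + h ^ 2)⁻¹ * (h ^ 2 + ε ^ 2)) := by gcongr
      _ = _ := by ring
  · rw [norm_mul, mul_assoc, weight]
    have h2 := hC x ε h hε (Or.inl h0)
    have h3 : min |h| 1 / (h ^ 2 + ε ^ 2) ≤ min |h| 1 / h ^ 2 := by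
      gcongr
      nlinarith [sq_nonneg ε]
    calc ‖U (s (x + h)) - U (s x)‖ * ‖weldKernel s s' x ε h‖
        ≤ (H * √|h|) * (C * (min |h| 1 / h ^ 2)) :=
          mul_le_mul (hH x h) (h2.trans (by gcongr)) (norm_nonneg _) (by positivity)
      _ = _ := by ring

theorem integrable_derivIntegrand (hs : IsNearId s s' b₀ β b₂) (hU : IsUpperBdd U)
    (hV : IsLowerBdd V) (hj : ∀ x : ℝ, V x = (s x - x : ℝ) + U (s x)) (x : ℝ) {ε : ℝ}
    (hε : 0 ≤ ε) : Integrable (derivIntegrand s s' U x ε) := by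
  obtain ⟨B, hB, hle⟩ := exists_norm_derivIntegrand_le hs hU hV hj
  refine hB.mono' (hs.measurable_derivIntegrand hU x ε).aestronglyMeasurable ?_
  exact (Measure.ae_ne volume 0).mono fun h h0 => hle x ε h hε h0

theorem deriv_lower_eq (hs : IsNearId s s' b₀ β b₂) (hU : IsUpperBdd U)
    (hV : IsLowerBdd V) (hj : ∀ x : ℝ, V x = (s x - x : ℝ) + U (s x)) (x : ℝ) {ε : ℝ}
    (hε : 0 < ε) : deriv V ((x : ℂ) - ε * I) =
      -(2 * Real.pi * I)⁻¹ * ((∫ h : ℝ, derivIntegrand s s' U x ε h)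
        - Real.pi * I / (1 + ε) ^ 2 * (s' x - 1 : ℝ)) := by
  have h := deriv_lower_eq_integral hs hU hV hj x hε
  obtain ⟨i1, e1⟩ := integral_odd_profile hε
  have e : ∀ h : ℝ, (((s (x + h) - s x - h : ℝ) : ℂ) / ((h : ℂ) + ε * I) ^ 2
        + (U (s (x + h)) - U (s x)) * weldKernel s s' x ε h)
      = derivIntegrand s s' U x ε h
        + (s' x - 1 : ℝ) * (((h / (1 + h ^ 2) : ℝ) : ℂ) / ((h : ℂ) + ε * I) ^ 2) := by
    intro h
    rw [derivIntegrand, shiftRemainder]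
    push_cast
    ring
  simp_rw [e] at h
  rw [integral_add (integrable_derivIntegrand hs hU hV hj x hε.le) (i1.const_mul _),
    integral_const_mul, e1] at h
  have hpi : (2 * Real.pi * I : ℂ) ≠ 0 := by simp [Real.pi_ne_zero]
  have h2 : deriv V ((x : ℂ) - ε * I) = -(2 * Real.pi * I)⁻¹ *
      (-(2 * Real.pi * I * deriv V ((x : ℂ) - ε * I))) := by
    field_simp
  rw [h2, h]
  ring

/-- The derivative of the lower function extends continuously to the real line. -/
theorem tendsto_deriv_lower (hs : IsNearId s s' b₀ β b₂) (hU : IsUpperBdd U)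
    (hV : IsLowerBdd V) (hj : ∀ x : ℝ, V x = (s x - x : ℝ) + U (s x)) (x : ℝ) :
    Tendsto (deriv V) (𝓝[{z : ℂ | z.im < 0}] (x : ℂ)) (𝓝 (boundaryDeriv s s' U x)) := by
  obtain ⟨B, hB, hle⟩ := exists_norm_derivIntegrand_le hs hU hV hj
  have hsc := hs.continuous
  have hsc' := hs.continuous_deriv
  have hUc := hU.continuous_real
  have key : Tendsto (fun z : ℂ => ∫ h : ℝ, derivIntegrand s s' U z.re (-z.im) h)
      (𝓝[{z : ℂ | z.im < 0}] (x : ℂ)) (𝓝 (∫ h : ℝ, derivIntegrand s s' U x 0 h)) := by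
    refine tendsto_integral_filter_of_dominated_convergence B ?_ ?_ hB ?_
    · exact Eventually.of_forall fun z =>
        (hs.measurable_derivIntegrand hU z.re (-z.im)).aestronglyMeasurable
    · filter_upwards [self_mem_nhdsWithin] with z hz
      exact (Measure.ae_ne volume 0).mono fun h h0 =>
        hle z.re (-z.im) h (by have : z.im < 0 := hz; linarith) h0
    · refine (Measure.ae_ne volume 0).mono fun h h0 => ?_
      refine Tendsto.mono_left ?_ nhdsWithin_le_nhds
      have hD : s (x + h) - s x ≠ 0 := by
        rw [sub_ne_zero]; intro h1
        exact h0 (by simpa using hs.strictMono.injective h1)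
      have hc : ContinuousAt (fun z : ℂ => derivIntegrand s s' U z.re (-z.im) h) (x : ℂ) := by
        unfold derivIntegrand shiftRemainder weldKernel
        have c1 : Continuous fun z : ℂ => U (s (z.re + h)) :=
          hUc.comp (by fun_prop : Continuous fun z : ℂ => s (z.re + h))
        have c2 : Continuous fun z : ℂ => U (s z.re) :=
          hUc.comp (by fun_prop : Continuous fun z : ℂ => s z.re)
        have n1 : ((h : ℂ) + ((-((x : ℂ)).im : ℝ) : ℂ) * I) ^ 2 ≠ 0 := by
          simpa using h0
        have n2 : (((s ((x : ℂ).re + h) - s (x : ℂ).re : ℝ) : ℂ)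
            + ((-(x : ℂ).im * s' (x : ℂ).re : ℝ) : ℂ) * I) ^ 2 ≠ 0 := by
          have : ((s (x + h) - s x : ℝ) : ℂ) ≠ 0 := by exact_mod_cast hD
          simpa using this
        refine ContinuousAt.add (ContinuousAt.div (by fun_prop) (by fun_prop) n1)
          (ContinuousAt.mul (c1.sub c2).continuousAt (ContinuousAt.sub
            (ContinuousAt.div (by fun_prop) (by fun_prop) n1)
            (ContinuousAt.div (by fun_prop) (by fun_prop) n2)))
      simpa using hc.tendsto
  have h2 : Tendsto (fun z : ℂ => (Real.pi * I / (1 + (-z.im : ℝ)) ^ 2 * (s' z.re - 1 : ℝ) : ℂ))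
      (𝓝[{z : ℂ | z.im < 0}] (x : ℂ)) (𝓝 (Real.pi * I * (s' x - 1 : ℝ))) := by
    refine Tendsto.mono_left ?_ nhdsWithin_le_nhds
    have hc : ContinuousAt
        (fun z : ℂ => (Real.pi * I / (1 + (-z.im : ℝ)) ^ 2 * (s' z.re - 1 : ℝ) : ℂ)) (x : ℂ) := by
      refine ContinuousAt.mul (ContinuousAt.div (by fun_prop) (by fun_prop) (by simp)) (by fun_prop)
    simpa using hc.tendsto
  have h3 := (key.sub h2).const_mul (-(2 * Real.pi * I : ℂ)⁻¹)
  refine h3.congr' ?_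
  filter_upwards [self_mem_nhdsWithin] with z hz
  have hz : z.im < 0 := hz
  have hz' : z = (z.re : ℂ) - (-z.im : ℝ) * I := by
    apply Complex.ext <;> simp
  conv_rhs => rw [hz']
  exact (deriv_lower_eq hs hU hV hj z.re (by linarith)).symm

theorem hasDerivAt_lower (hs : IsNearId s s' b₀ β b₂) (hU : IsUpperBdd U)
    (hV : IsLowerBdd V) (hj : ∀ x : ℝ, V x = (s x - x : ℝ) + U (s x)) (x : ℝ) :
    HasDerivAt (fun t : ℝ => V t) (boundaryDeriv s s' U x) x := by
  have hcont : ContinuousOn V {z : ℂ | z.im ≤ 0} := by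
    have h1 : ContinuousOn (fun z => V (-z)) {z : ℂ | 0 ≤ z.im} := IsUpperBdd.cont hV
    have h2 := h1.comp (continuous_neg.continuousOn (s := {z : ℂ | z.im ≤ 0}))
      (fun z (hz : z.im ≤ 0) => show 0 ≤ (-z).im by simpa using hz)
    exact h2.congr fun z _ => by simp
  have hcl : closure {z : ℂ | z.im < 0} = {z : ℂ | z.im ≤ 0} := Complex.closure_setOfPred_im_lt 0
  have ht := tendsto_deriv_lower hs hU hV hj x
  have h := hasFDerivWithinAt_closure_of_tendsto_fderiv (f := V) (s := {z : ℂ | z.im < 0})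
    (x := (x : ℂ))
    (f' := ((1 : ℂ →L[ℂ] ℂ).smulRight (boundaryDeriv s s' U x)).restrictScalars ℝ)
    (fun z (hz : z.im < 0) =>
      ((hV.differentiableAt hz).restrictScalars ℝ).differentiableWithinAt)
    (convex_halfSpace_im_lt 0) (isOpen_lt continuous_im continuous_const)
    (fun z hz => (hcont z (by rwa [hcl] at hz)).mono fun w (hw : w.im < 0) => le_of_lt hw) ?_
  · rw [hcl] at h
    have h2 : HasDerivWithinAt (fun t : ℝ => (t : ℂ)) 1 Set.univ x :=
      (Complex.ofRealCLM.hasDerivAt (x := x)).hasDerivWithinAt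
    have h3 := h.comp_hasDerivWithinAt x h2 (fun t _ => by simp)
    rw [hasDerivWithinAt_univ] at h3
    refine h3.congr_deriv ?_
    simp
  · have hlin : Continuous fun a : ℂ => ((1 : ℂ →L[ℂ] ℂ).smulRight a).restrictScalars ℝ := by
      have : Continuous fun a : ℂ => (1 : ℂ →L[ℂ] ℂ).smulRight a :=
        (ContinuousLinearMap.smulRightL ℂ ℂ ℂ 1).continuous
      exact (ContinuousLinearMap.restrictScalarsL ℂ ℂ ℂ ℝ ℝ).continuous.comp this
    refine ((hlin.tendsto _).comp ht).congr' ?_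
    filter_upwards [self_mem_nhdsWithin] with z hz
    have hd := (hV.differentiableAt hz).hasDerivAt.hasFDerivAt.restrictScalars ℝ
    rw [hd.fderiv]
    rfl

end Regularity

/-! ### Quantitative estimates -/

theorem integral_eq_integral_Ioi_add_neg {F : ℝ → ℂ} (hF : Integrable F) :
    ∫ h, F h = ∫ h in Set.Ioi (0 : ℝ), (F h + F (-h)) := by
  rw [integral_add hF.integrableOn hF.comp_neg.integrableOn, integral_comp_neg_Ioi, neg_zero,
    add_comm, intervalIntegral.integral_Iic_add_Ioi hF.integrableOn hF.integrableOn]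

theorem norm_integral_Ioi_le_of_three_ranges {G : ℝ → ℂ} (hG : IntegrableOn G (Set.Ioi 0))
    {δ R p q t : ℝ} (hδ : 0 < δ) (hR : δ ≤ R)
    (h1 : ∀ h, 0 < h → h ≤ δ → ‖G h‖ ≤ p)
    (h2 : ∀ h, δ < h → h ≤ R → ‖G h‖ ≤ q / h)
    (h3 : ∀ h, R < h → ‖G h‖ ≤ t * (√h / h ^ 2)) :
    ‖∫ h in Set.Ioi 0, G h‖ ≤ p * δ + q * Real.log (R / δ) + t * (2 / √R) := by
  have hR0 : 0 < R := hδ.trans_le hR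
  have i1 : IntegrableOn G (Set.Ioc 0 δ) := hG.mono_set Set.Ioc_subset_Ioi_self
  have i2 : IntegrableOn G (Set.Ioc δ R) :=
    hG.mono_set fun x hx => hδ.trans hx.1
  have i3 : IntegrableOn G (Set.Ioi R) := hG.mono_set (Set.Ioi_subset_Ioi hR0.le)
  have e1 : ∫ h in Set.Ioi 0, G h
      = (∫ h in Set.Ioc 0 δ, G h) + ((∫ h in Set.Ioc δ R, G h) + ∫ h in Set.Ioi R, G h) := by
    rw [← setIntegral_union (Set.Ioc_disjoint_Ioi le_rfl) measurableSet_Ioi i2 i3,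
      Set.Ioc_union_Ioi_eq_Ioi hR, ← setIntegral_union (Set.Ioc_disjoint_Ioi le_rfl)
      measurableSet_Ioi i1 (hG.mono_set (Set.Ioi_subset_Ioi hδ.le)),
      Set.Ioc_union_Ioi_eq_Ioi hδ.le]
  have b1 : ‖∫ h in Set.Ioc 0 δ, G h‖ ≤ p * δ := by
    have := norm_setIntegral_le_of_norm_le_const (μ := volume) (s := Set.Ioc 0 δ) (f := G) (C := p)
      (by simp) (fun x hx => h1 x hx.1 hx.2)
    simpa [hδ.le] using this
  have b2 : ‖∫ h in Set.Ioc δ R, G h‖ ≤ q * Real.log (R / δ) := by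
    have hi : IntervalIntegrable (fun h : ℝ => q / h) volume δ R := by
      refine ContinuousOn.intervalIntegrable fun x hx => ?_
      rw [Set.uIcc_of_le hR] at hx
      have : x ≠ 0 := (hδ.trans_le hx.1).ne'
      exact (ContinuousAt.div continuousAt_const continuousAt_id this).continuousWithinAt
    have := intervalIntegral.norm_integral_le_of_norm_le hR (f := G) (g := fun h => q / h)
      (Eventually.of_forall fun x hx => h2 x hx.1 hx.2) hi
    rw [intervalIntegral.integral_of_le hR] at this
    refine this.trans (le_of_eq ?_)
    simp_rw [div_eq_mul_inv q]
    rw [intervalIntegral.integral_const_mul, integral_inv_of_pos hδ hR0]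
  have b3 : ‖∫ h in Set.Ioi R, G h‖ ≤ t * (2 / √R) := by
    have e : ∀ h ∈ Set.Ioi R, h ^ (-(3 / 2) : ℝ) = √h / h ^ 2 := fun h hh =>
      (sqrt_div_sq (hR0.trans hh)).symm
    have i4 : IntegrableOn (fun h : ℝ => √h / h ^ 2) (Set.Ioi R) :=
      (integrableOn_Ioi_rpow_of_lt (a := -(3 / 2)) (by norm_num) hR0).congr_fun e measurableSet_Ioi
    have i5 : ∫ h in Set.Ioi R, √h / h ^ 2 = 2 / √R := by
      rw [← setIntegral_congr_fun measurableSet_Ioi e, integral_Ioi_rpow_of_lt (by norm_num) hR0]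
      have : (-(3 / 2) + 1 : ℝ) = -(1 / 2) := by norm_num
      rw [this, Real.rpow_neg hR0.le, ← Real.sqrt_eq_rpow]
      have := Real.sqrt_pos.mpr hR0
      field_simp
    have := norm_integral_le_of_norm_le (μ := volume.restrict (Set.Ioi R)) (f := G)
      (i4.const_mul t) ((ae_restrict_iff' measurableSet_Ioi).mpr
        (Eventually.of_forall fun x hx => h3 x hx))
    rwa [integral_const_mul, i5] at this
  rw [e1]
  refine (norm_add_le _ _).trans ?_
  have := norm_add_le (∫ h in Set.Ioc δ R, G h) (∫ h in Set.Ioi R, G h)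
  linarith

section Estimates

variable {s s' : ℝ → ℝ} {b₀ β b₂ : ℝ} {U V : ℂ → ℂ}

theorem IsNearId.norm_weldKernel_zero_le (hs : IsNearId s s' b₀ β b₂) (x : ℝ) {h : ℝ} (h0 : h ≠ 0) :
    ‖weldKernel s s' x 0 h‖ ≤ 2 * ((1 + β) / (1 - β) ^ 2) * b₂ / |h| ∧
      ‖weldKernel s s' x 0 h‖ ≤ 4 * ((1 + β) / (1 - β) ^ 2) * β / h ^ 2 := by
  have hh : h ^ 2 = |h| ^ 2 := (sq_abs h).symm
  have hp : 0 < |h| := abs_pos.mpr h0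
  constructor
  · refine (hs.norm_weldKernel_le (e := b₂ * |h|) le_rfl (Or.inl h0) ?_ (hs.taylor_left x h)
      (hs.taylor_right x h)).trans (le_of_eq ?_)
    · simpa using hs.lipschitz (x + h) x
    · rw [hh]; field_simp; ring
  · refine (hs.norm_weldKernel_le (e := 2 * β) le_rfl (Or.inl h0) (hs.abs_deriv_sub_deriv_le _ _)
      (hs.abs_sub_sub_deriv_le _ _ _) (hs.abs_sub_sub_deriv_le _ _ _)).trans (le_of_eq ?_)
    field_simp; ring

theorem IsNearId.abs_second_difference_le (hs : IsNearId s s' b₀ β b₂) (x h : ℝ) :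
    |s (x + h) + s (x - h) - 2 * s x| ≤ 2 * b₂ * h ^ 2 ∧
    |s (x + h) + s (x - h) - 2 * s x| ≤ 2 * β * |h| ∧
    |s (x + h) + s (x - h) - 2 * s x| ≤ 4 * b₀ := by
  have e : |h| * |h| = h ^ 2 := by rw [← sq, sq_abs]
  have key : ∀ p : ℝ, |s (x + h) + s (x - h) - 2 * s x|
      ≤ |s (x + h) - s x - p * h| + |s (x + -h) - s x - p * -h| := by
    intro p
    have : s (x + h) + s (x - h) - 2 * s x
        = (s (x + h) - s x - p * h) + (s (x + -h) - s x - p * -h) := by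
      rw [← sub_eq_add_neg]; ring
    rw [this]
    exact abs_add_le _ _
  refine ⟨?_, ?_, ?_⟩
  · have h1 := hs.taylor_left x h
    have h2 := hs.taylor_left x (-h)
    rw [abs_neg] at h2
    rw [mul_assoc, e] at h1 h2
    linarith [key (s' x)]
  · have h1 := hs.abs_shift_sub_le x h
    have h2 := hs.abs_shift_sub_le x (-h)
    rw [abs_neg] at h2
    have := key 1
    rw [one_mul, one_mul] at this
    linarith
  · have h1 := hs.abs_shift_sub_le' x h
    have h2 := hs.abs_shift_sub_le' x (-h)
    have := key 1
    rw [one_mul, one_mul] at this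
    linarith

/-- The folded boundary integrand: the odd profile cancels, and a second difference of the shift is
left. -/
theorem norm_derivIntegrand_add_neg_le (x h : ℝ) :
    ‖derivIntegrand s s' U x 0 h + derivIntegrand s s' U x 0 (-h)‖
      ≤ |s (x + h) + s (x - h) - 2 * s x| / h ^ 2
        + (‖U (s (x + h)) - U (s x)‖ * ‖weldKernel s s' x 0 h‖
          + ‖U (s (x + -h)) - U (s x)‖ * ‖weldKernel s s' x 0 (-h)‖) := by
  have e : derivIntegrand s s' U x 0 h + derivIntegrand s s' U x 0 (-h)
      = ((s (x + h) + s (x - h) - 2 * s x : ℝ) : ℂ) / (h : ℂ) ^ 2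
        + ((U (s (x + h)) - U (s x)) * weldKernel s s' x 0 h
          + (U (s (x + -h)) - U (s x)) * weldKernel s s' x 0 (-h)) := by
    have e1 : shiftRemainder s s' x h + shiftRemainder s s' x (-h)
        = s (x + h) + s (x - h) - 2 * s x := by
      unfold shiftRemainder; rw [← sub_eq_add_neg]; ring
    rw [derivIntegrand, derivIntegrand, ← e1]
    push_cast
    ring
  rw [e]
  refine (norm_add_le _ _).trans (add_le_add (le_of_eq ?_) ((norm_add_le _ _).trans
    (le_of_eq ?_)))
  · rw [norm_div, norm_pow, Complex.norm_real, Complex.norm_real, Real.norm_eq_abs,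
      Real.norm_eq_abs, sq_abs]
  · rw [norm_mul, norm_mul]

/-- The main estimate: the boundary derivative in terms of a Lipschitz constant `L` and a
Hölder-`1/2` constant `N` of the upper function transported by `s`. -/
theorem norm_boundaryDeriv_sub_le (hs : IsNearId s s' b₀ β b₂) (hU : IsUpperBdd U)
    (hV : IsLowerBdd V) (hj : ∀ x : ℝ, V x = (s x - x : ℝ) + U (s x)) {L N κ δ R : ℝ}
    (hκ : (1 + β) / (1 - β) ^ 2 ≤ κ) (hδ : 0 < δ) (hR : δ ≤ R)
    (hL : ∀ x h : ℝ, ‖U (s (x + h)) - U (s x)‖ ≤ L * |h|)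
    (hN : ∀ x h : ℝ, ‖U (s (x + h)) - U (s x)‖ ≤ N * √|h|) (x : ℝ) :
    ‖boundaryDeriv s s' U x - ((s' x - 1) / 2 : ℝ)‖ ≤ (2 * Real.pi)⁻¹ *
      ((2 * b₂ + 4 * κ * b₂ * L) * δ + (2 * β + 8 * κ * β * L) * Real.log (R / δ)
        + (4 * b₀ / √R + 8 * κ * β * N) * (2 / √R)) := by
  have hL0 : 0 ≤ L := by simpa using (norm_nonneg _).trans (hL 0 1)
  have hN0 : 0 ≤ N := by simpa using (norm_nonneg _).trans (hN 0 1)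
  have hβ := hs.beta_nonneg
  have hb := hs.b₀_nonneg
  have hb2 := hs.b₂_nonneg
  have hR0 : 0 < R := hδ.trans_le hR
  have hi := integrable_derivIntegrand hs hU hV hj x le_rfl
  have hpi := Real.pi_pos
  have e : boundaryDeriv s s' U x - ((s' x - 1) / 2 : ℝ)
      = -(2 * Real.pi * I)⁻¹ * ∫ h : ℝ, derivIntegrand s s' U x 0 h := by
    have : (Real.pi : ℂ) ≠ 0 := by exact_mod_cast hpi.ne'
    rw [boundaryDeriv]
    push_cast
    field_simp
    ring
  have en : ‖-(2 * Real.pi * I : ℂ)⁻¹‖ = (2 * Real.pi)⁻¹ := by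
    rw [norm_neg, norm_inv, norm_mul, norm_mul, Complex.norm_I, Complex.norm_real,
      Real.norm_of_nonneg hpi.le, Complex.norm_ofNat, mul_one]
  rw [e, norm_mul, en]
  refine mul_le_mul_of_nonneg_left ?_ (by positivity)
  rw [integral_eq_integral_Ioi_add_neg hi]
  -- bounds of one kernel term, for either sign of `h`
  have k1 : ∀ h : ℝ, h ≠ 0 → ‖U (s (x + h)) - U (s x)‖ * ‖weldKernel s s' x 0 h‖ ≤ 2 * κ * b₂ * L := by
    intro h h0
    have hp := abs_pos.mpr h0
    calc _ ≤ (L * |h|) * (2 * κ * b₂ / |h|) :=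
          mul_le_mul (hL x h) ((hs.norm_weldKernel_zero_le x h0).1.trans (by gcongr))
            (norm_nonneg _) (by positivity)
      _ = _ := by field_simp
  have k2 : ∀ h : ℝ, h ≠ 0 →
      ‖U (s (x + h)) - U (s x)‖ * ‖weldKernel s s' x 0 h‖ ≤ 4 * κ * β * L / |h| := by
    intro h h0
    have hp := abs_pos.mpr h0
    calc _ ≤ (L * |h|) * (4 * κ * β / h ^ 2) :=
          mul_le_mul (hL x h) ((hs.norm_weldKernel_zero_le x h0).2.trans (by gcongr))
            (norm_nonneg _) (by positivity)
      _ = _ := by rw [← sq_abs h]; field_simp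
  have k3 : ∀ h : ℝ, h ≠ 0 →
      ‖U (s (x + h)) - U (s x)‖ * ‖weldKernel s s' x 0 h‖ ≤ 4 * κ * β * N * (√|h| / h ^ 2) := by
    intro h h0
    calc _ ≤ (N * √|h|) * (4 * κ * β / h ^ 2) :=
          mul_le_mul (hN x h) ((hs.norm_weldKernel_zero_le x h0).2.trans (by gcongr))
            (norm_nonneg _) (by positivity)
      _ = _ := by ring
  refine norm_integral_Ioi_le_of_three_ranges (hi.add hi.comp_neg).integrableOn hδ hR ?_ ?_ ?_
  · intro h h0 _
    refine (norm_derivIntegrand_add_neg_le x h).trans ?_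
    have t1 : |s (x + h) + s (x - h) - 2 * s x| / h ^ 2 ≤ 2 * b₂ := by
      rw [div_le_iff₀ (by positivity)]
      exact (hs.abs_second_difference_le x h).1
    linarith [k1 h h0.ne', k1 (-h) (neg_ne_zero.mpr h0.ne')]
  · intro h hh _
    have h0 : 0 < h := hδ.trans hh
    refine (norm_derivIntegrand_add_neg_le x h).trans ?_
    have t1 : |s (x + h) + s (x - h) - 2 * s x| / h ^ 2 ≤ 2 * β / h := by
      rw [div_le_div_iff₀ (by positivity) h0]
      have := (hs.abs_second_difference_le x h).2.1
      rw [abs_of_pos h0] at this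
      calc _ ≤ 2 * β * h * h := by gcongr
        _ = _ := by ring
    have t2 := k2 h h0.ne'
    have t3 := k2 (-h) (neg_ne_zero.mpr h0.ne')
    rw [abs_neg] at t3
    rw [abs_of_pos h0] at t2 t3
    have : (2 * β + 8 * κ * β * L) / h
        = 2 * β / h + (4 * κ * β * L / h + 4 * κ * β * L / h) := by ring
    linarith
  · intro h hh
    have h0 : 0 < h := hR0.trans hh
    refine (norm_derivIntegrand_add_neg_le x h).trans ?_
    have t1 : |s (x + h) + s (x - h) - 2 * s x| / h ^ 2 ≤ 4 * b₀ / √R * (√h / h ^ 2) := by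
      rw [mul_div_assoc']
      gcongr
      refine (hs.abs_second_difference_le x h).2.2.trans ?_
      have h1 : √R ≤ √h := Real.sqrt_le_sqrt hh.le
      have h2 := Real.sqrt_pos.mpr hR0
      rw [div_mul_eq_mul_div, le_div_iff₀ h2]
      gcongr
    have t2 := k3 h h0.ne'
    have t3 := k3 (-h) (neg_ne_zero.mpr h0.ne')
    rw [abs_neg, neg_sq] at t3
    rw [abs_of_pos h0] at t2 t3
    linarith

/-- Decay of the derivative of the upper function away from the real line: the jump relation makes
the difference of the two boundary values small. -/
theorem norm_deriv_upper_le_div (hs : IsNearId s s' b₀ β b₂) (hU : IsUpperBdd U)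
    (hV : IsLowerBdd V) (hj : ∀ x : ℝ, V x = (s x - x : ℝ) + U (s x)) {L : ℝ}
    (hL : ∀ x y : ℝ, ‖U x - U y‖ ≤ L * |x - y|) {z : ℂ} (hz : 0 < z.im) :
    ‖deriv U z‖ ≤ (1 + L) * b₀ / 2 / z.im := by
  have hL0 : 0 ≤ L := by simpa using (norm_nonneg _).trans (hL 1 0)
  have hdiff : ∀ x : ℝ, ‖U x - V x‖ ≤ (1 + L) * b₀ := by
    intro x
    have e : U x - V x = -((s x - x : ℝ) : ℂ) + (U x - U (s x)) := by rw [hj]; ring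
    rw [e]
    refine (norm_add_le _ _).trans ?_
    rw [norm_neg, Complex.norm_real, Real.norm_eq_abs]
    have h1 := hs.abs_sub_le x
    have h2 := hL x (s x)
    rw [abs_sub_comm] at h2
    have h3 : L * |s x - x| ≤ L * b₀ := by gcongr
    linarith
  obtain ⟨A, hA⟩ := hU.bdd
  obtain ⟨A', hA'⟩ := id hV.bdd
  have i1 := integrable_div_sub_sq hU.continuous_real (N := A) (fun x => hA x (by simp)) hz.ne'
  have i2 := integrable_div_sub_sq hV.continuous_real (N := A')
    (fun x => by simpa using hA' (-x) (by simp)) hz.ne'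
  have h1 := hU.integral_div_sq hz
  rw [← sub_zero (∫ x : ℝ, U x / ((x : ℂ) - z) ^ 2), ← hV.integral_div_sq_eq_zero hz,
    ← integral_sub i1 i2] at h1
  have hi := integrable_inv_norm_sub_sq z hz.ne'
  have h2 : ‖∫ x : ℝ, (U x / ((x : ℂ) - z) ^ 2 - V x / ((x : ℂ) - z) ^ 2)‖
      ≤ ∫ x : ℝ, (1 + L) * b₀ * (‖(x : ℂ) - z‖ ^ 2)⁻¹ := by
    refine norm_integral_le_of_norm_le (hi.1.const_mul _) (Eventually.of_forall fun x => ?_)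
    rw [← sub_div, norm_div, norm_pow, div_eq_mul_inv]
    gcongr
    exact hdiff x
  have hpi := Real.pi_pos
  rw [h1, integral_const_mul, hi.2, abs_of_pos hz, norm_mul, norm_mul, norm_mul, Complex.norm_I,
    Complex.norm_real, Real.norm_of_nonneg hpi.le, Complex.norm_ofNat, mul_one] at h2
  rw [div_div, le_div_iff₀ (by positivity)]
  rw [mul_div_assoc', le_div_iff₀ hz] at h2
  have : Real.pi * (‖deriv U z‖ * (2 * z.im)) ≤ Real.pi * ((1 + L) * b₀) := by linarith
  exact le_of_mul_le_mul_left this hpi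

/-- The boundary values of the upper function are Hölder continuous of exponent `1/2`, with a
constant controlled by their Lipschitz constant `L` and the size of the shift only; this bounds
their growth at large distances. -/
theorem norm_upper_sub_le_sqrt (hs : IsNearId s s' b₀ β b₂) (hU : IsUpperBdd U)
    (hV : IsLowerBdd V) (hj : ∀ x : ℝ, V x = (s x - x : ℝ) + U (s x)) {L : ℝ}
    (hL : ∀ x y : ℝ, ‖U x - U y‖ ≤ L * |x - y|) (x y : ℝ) :
    ‖U x - U y‖ ≤ 5 * ((L + (1 + L) * b₀ / 2) / 2) * √|x - y| := by
  have hL0 : 0 ≤ L := by simpa using (norm_nonneg _).trans (hL 1 0)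
  have hb := hs.b₀_nonneg
  refine hU.norm_sub_le_sqrt (by positivity) (fun z hz => ?_) x y
  have h1 := hU.norm_deriv_le_of_lipschitz hL hz
  have h2 := norm_deriv_upper_le_div hs hU hV hj hL hz
  have hr := Real.sqrt_pos.mpr hz
  have hr2 := Real.sq_sqrt hz.le
  rw [le_div_iff₀ hr]
  rw [le_div_iff₀ hz] at h2
  set C := (1 + L) * b₀ / 2
  have hC : 0 ≤ C := by positivity
  -- the geometric mean of the bounds `L` and `C / Im z` is at most their arithmetic mean
  refine abs_le_of_sq_le_sq' ?_ (by positivity) |>.2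
  have h3 : ‖deriv U z‖ * (‖deriv U z‖ * z.im) ≤ L * C :=
    mul_le_mul h1 h2 (by positivity) hL0
  nlinarith [sq_nonneg (L - C)]

theorem exists_norm_boundaryDeriv_sub_le (hs : IsNearId s s' b₀ β b₂) (hU : IsUpperBdd U)
    (hV : IsLowerBdd V) (hj : ∀ x : ℝ, V x = (s x - x : ℝ) + U (s x)) :
    ∃ L : ℝ, ∀ x, ‖boundaryDeriv s s' U x - (s' x - 1 : ℝ)‖ ≤ L := by
  obtain ⟨B, hB, hle⟩ := exists_norm_derivIntegrand_le hs hU hV hj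
  have hpi := Real.pi_pos
  refine ⟨‖-(2 * Real.pi * I : ℂ)⁻¹‖ * ((∫ h, B h) + Real.pi * β) + β, fun x => ?_⟩
  refine (norm_sub_le _ _).trans (add_le_add ?_ ?_)
  · rw [boundaryDeriv, norm_mul]
    gcongr
    refine (norm_sub_le _ _).trans (add_le_add ?_ ?_)
    · exact norm_integral_le_of_norm_le hB
        ((Measure.ae_ne volume 0).mono fun h h0 => hle x 0 h le_rfl h0)
    · rw [norm_mul, norm_mul, Complex.norm_I, mul_one, Complex.norm_real, Complex.norm_real,
        Real.norm_of_nonneg hpi.le]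
      gcongr
      exact hs.abs_deriv_sub_le x
  · rw [Complex.norm_real]
    exact hs.abs_deriv_sub_le x

theorem hasDerivAt_upper_comp (hs : IsNearId s s' b₀ β b₂) (hU : IsUpperBdd U)
    (hV : IsLowerBdd V) (hj : ∀ x : ℝ, V x = (s x - x : ℝ) + U (s x)) (x : ℝ) :
    HasDerivAt (fun t : ℝ => U (s t)) (boundaryDeriv s s' U x - (s' x - 1 : ℝ)) x := by
  have h1 := hasDerivAt_lower hs hU hV hj x
  have h2 : HasDerivAt (fun t : ℝ => ((s t - t : ℝ) : ℂ)) ((s' x - 1 : ℝ) : ℂ) x :=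
    ((hs.hasDerivAt x).sub (hasDerivAt_id x)).ofReal_comp
  refine (h1.sub h2).congr_of_eventuallyEq (Eventually.of_forall fun t => ?_)
  simp [hj]

theorem norm_upper_sub_le_of_comp (hs : IsNearId s s' b₀ β b₂) {L : ℝ} (hL0 : 0 ≤ L)
    (hL : ∀ x h : ℝ, ‖U (s (x + h)) - U (s x)‖ ≤ L * |h|) (x y : ℝ) :
    ‖U x - U y‖ ≤ L / (1 - β) * |x - y| := by
  obtain ⟨p, rfl⟩ := hs.surjective x
  obtain ⟨q, rfl⟩ := hs.surjective y
  have h1 := hL q (p - q)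
  have h2 := hs.le_abs_image_sub q (p - q)
  rw [add_sub_cancel] at h1 h2
  have hβ : 0 < 1 - β := by linarith [hs.lt_one]
  refine h1.trans ?_
  rw [div_mul_eq_mul_div, le_div_iff₀ hβ]
  calc _ = L * ((1 - β) * |p - q|) := by ring
    _ ≤ _ := by gcongr

/-- One step of the estimate for shifts of the size considered here: a bound `L` of the derivative
of `U ∘ s` is improved to an affine function of `L` of slope less than one. -/
theorem boundaryDeriv_bound_step (hs : IsNearId s s' b₀ β b₂) (hU : IsUpperBdd U)
    (hV : IsLowerBdd V) (hj : ∀ x : ℝ, V x = (s x - x : ℝ) + U (s x)) (hb₀ : b₀ ≤ 1 / 4)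
    (hβ : β ≤ 0.01852) (hb₂ : b₂ ≤ 0.7854) {L : ℝ}
    (hL : ∀ x, ‖boundaryDeriv s s' U x - (s' x - 1 : ℝ)‖ ≤ L) (x : ℝ) :
    ‖boundaryDeriv s s' U x - ((s' x - 1) / 2 : ℝ)‖ ≤ 0.0598 + 0.225 * L := by
  have hL0 : 0 ≤ L := (norm_nonneg _).trans (hL 0)
  have hβ0 := hs.beta_nonneg
  have hb0 := hs.b₀_nonneg
  have hb2 := hs.b₂_nonneg
  have hLip : ∀ x h : ℝ, ‖U (s (x + h)) - U (s x)‖ ≤ L * |h| := by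
    intro x h
    have := convex_univ.norm_image_sub_le_of_norm_hasDerivWithin_le (C := L)
      (fun t _ => (hasDerivAt_upper_comp hs hU hV hj t).hasDerivWithinAt)
      (fun t _ => hL t) (Set.mem_univ x) (Set.mem_univ (x + h))
    simpa using this
  have hLU := norm_upper_sub_le_of_comp hs hL0 hLip
  have hLb : L / (1 - β) ≤ 1.0189 * L := by
    rw [div_le_iff₀ (by linarith)]
    nlinarith
  have hN : ∀ x h : ℝ, ‖U (s (x + h)) - U (s x)‖ ≤ (0.3184 + 2.92 * L) * √|h| := by
    intro x h
    have h1 := norm_upper_sub_le_sqrt hs hU hV hj hLU (s (x + h)) (s x)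
    have h2 : √|s (x + h) - s x| ≤ (1 + β) * √|h| := by
      refine Real.sqrt_le_iff.mpr ⟨by positivity, ?_⟩
      rw [mul_pow, Real.sq_sqrt (abs_nonneg h)]
      refine (hs.abs_image_sub_le x h).trans ?_
      gcongr
      nlinarith
    have h3 : 5 * ((L / (1 - β) + (1 + L / (1 - β)) * b₀ / 2) / 2)
        ≤ 5 * ((1.0189 * L + (1 + 1.0189 * L) * (1 / 4) / 2) / 2) := by
      gcongr
    calc _ ≤ _ := h1
      _ ≤ 5 * ((1.0189 * L + (1 + 1.0189 * L) * (1 / 4) / 2) / 2) * ((1 + β) * √|h|) := by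
        refine mul_le_mul h3 h2 (Real.sqrt_nonneg _) (by positivity)
      _ = (5 * ((1.0189 * L + (1 + 1.0189 * L) * (1 / 4) / 2) / 2) * (1 + β)) * √|h| := by ring
      _ ≤ _ := by
        gcongr
        nlinarith
  have hκ : (1 + β) / (1 - β) ^ 2 ≤ 1.0574 := by
    have : 0 < 1 - β := by linarith
    rw [div_le_iff₀ (by positivity)]
    nlinarith
  -- the cut-offs `1/32` and `64` nearly minimize the bound for the extreme parameters
  have h := norm_boundaryDeriv_sub_le hs hU hV hj hκ (δ := 1 / 32) (R := 64) (by norm_num)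
    (by norm_num) hLip hN x
  refine h.trans ?_
  have hlog : Real.log (64 / (1 / 32)) ≤ 7.62462 := by
    have : (64 / (1 / 32) : ℝ) = 2 ^ 11 := by norm_num
    rw [this, Real.log_pow]
    have := Real.log_two_lt_d9
    norm_num at this ⊢
    linarith
  have hsqrt : √(64 : ℝ) = 8 := by
    rw [show (64 : ℝ) = 8 ^ 2 by norm_num]; exact Real.sqrt_sq (by norm_num)
  have hlog0 : 0 ≤ Real.log (64 / (1 / 32)) := Real.log_nonneg (by norm_num)
  rw [hsqrt]
  have hE : (2 * b₂ + 4 * 1.0574 * b₂ * L) * (1 / 32)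
      + (2 * β + 8 * 1.0574 * β * L) * Real.log (64 / (1 / 32))
        + (4 * b₀ / 8 + 8 * 1.0574 * β * (0.3184 + 2.92 * L)) * (2 / 8)
      ≤ (2 * 0.7854 + 4 * 1.0574 * 0.7854 * L) * (1 / 32)
      + (2 * 0.01852 + 8 * 1.0574 * 0.01852 * L) * 7.62462
        + (4 * (1 / 4) / 8 + 8 * 1.0574 * 0.01852 * (0.3184 + 2.92 * L)) * (2 / 8) := by
    gcongr
  have hpi := Real.pi_gt_d4
  rw [inv_mul_le_iff₀ (by positivity)]
  nlinarith

/-- The estimate closes: the supremum `L` of the derivative of `U ∘ s` is finite, and it satisfies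
`L ≤ 0.06906 + 0.225 L`. -/
theorem norm_boundaryDeriv_le (hs : IsNearId s s' b₀ β b₂) (hU : IsUpperBdd U)
    (hV : IsLowerBdd V) (hj : ∀ x : ℝ, V x = (s x - x : ℝ) + U (s x)) (hb₀ : b₀ ≤ 1 / 4)
    (hβ : β ≤ 0.01852) (hb₂ : b₂ ≤ 0.7854) (x : ℝ) :
    ‖boundaryDeriv s s' U x‖ ≤ 0.09 ∧ ‖boundaryDeriv s s' U x - (s' x - 1 : ℝ)‖ ≤ 0.09 := by
  have hhalf : ∀ x, ‖(((s' x - 1) / 2 : ℝ) : ℂ)‖ ≤ 0.00926 := by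
    intro x
    rw [Complex.norm_real, Real.norm_eq_abs, abs_div, abs_two]
    have := hs.abs_deriv_sub_le x
    linarith
  have hle : ∀ L : ℝ, (∀ x, ‖boundaryDeriv s s' U x - (s' x - 1 : ℝ)‖ ≤ L) → ∀ x,
      ‖boundaryDeriv s s' U x‖ ≤ 0.06906 + 0.225 * L ∧
        ‖boundaryDeriv s s' U x - (s' x - 1 : ℝ)‖ ≤ 0.06906 + 0.225 * L := by
    intro L hL x
    have h1 := boundaryDeriv_bound_step hs hU hV hj hb₀ hβ hb₂ hL x
    have h2 := hhalf x
    constructor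
    · have h3 := norm_add_le (boundaryDeriv s s' U x - ((s' x - 1) / 2 : ℝ)) (((s' x - 1) / 2 : ℝ) : ℂ)
      rw [sub_add_cancel] at h3
      linarith
    · have e : boundaryDeriv s s' U x - (s' x - 1 : ℝ)
          = (boundaryDeriv s s' U x - ((s' x - 1) / 2 : ℝ)) - (((s' x - 1) / 2 : ℝ) : ℂ) := by
        push_cast; ring
      rw [e]
      have h3 := norm_sub_le (boundaryDeriv s s' U x - ((s' x - 1) / 2 : ℝ)) (((s' x - 1) / 2 : ℝ) : ℂ)
      linarith
  obtain ⟨L₀, hL₀⟩ := exists_norm_boundaryDeriv_sub_le hs hU hV hj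
  have hbdd : BddAbove (Set.range fun x => ‖boundaryDeriv s s' U x - (s' x - 1 : ℝ)‖) :=
    ⟨L₀, by rintro _ ⟨x, rfl⟩; exact hL₀ x⟩
  set L := ⨆ x, ‖boundaryDeriv s s' U x - (s' x - 1 : ℝ)‖ with hLdef
  have hL : ∀ x, ‖boundaryDeriv s s' U x - (s' x - 1 : ℝ)‖ ≤ L := fun x => le_ciSup hbdd x
  have hfix : L ≤ 0.06906 + 0.225 * L := ciSup_le fun x => (hle L hL x).2
  have := hle L hL x
  constructor <;> linarith [this.1, this.2]

/-- Bounds of the derivatives of both functions, on the real line and off it. -/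
theorem deriv_bounds_of_isNearId (hs : IsNearId s s' b₀ β b₂) (hU : IsUpperBdd U)
    (hV : IsLowerBdd V) (hj : ∀ x : ℝ, V x = (s x - x : ℝ) + U (s x)) (hb₀ : b₀ ≤ 1 / 4)
    (hβ : β ≤ 0.01852) (hb₂ : b₂ ≤ 0.7854) :
    (∀ x : ℝ, DifferentiableAt ℝ (fun t : ℝ => V t) x ∧ ‖deriv (fun t : ℝ => V t) x‖ ≤ 0.1) ∧
    (∀ x : ℝ, DifferentiableAt ℝ (fun t : ℝ => U t) x ∧ ‖deriv (fun t : ℝ => U t) x‖ ≤ 0.1) ∧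
    (∀ z : ℂ, z.im < 0 → ‖deriv V z‖ ≤ 0.1) ∧ (∀ z : ℂ, 0 < z.im → ‖deriv U z‖ ≤ 0.1) := by
  have hbd := norm_boundaryDeriv_le hs hU hV hj hb₀ hβ hb₂
  have hVd := hasDerivAt_lower hs hU hV hj
  have hcd := hasDerivAt_upper_comp hs hU hV hj
  have hLip : ∀ x h : ℝ, ‖U (s (x + h)) - U (s x)‖ ≤ 0.09 * |h| := by
    intro x h
    have := convex_univ.norm_image_sub_le_of_norm_hasDerivWithin_le (C := 0.09)
      (fun t _ => (hcd t).hasDerivWithinAt)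
      (fun t _ => (hbd t).2) (Set.mem_univ x) (Set.mem_univ (x + h))
    simpa using this
  have hLU : ∀ x y : ℝ, ‖U x - U y‖ ≤ 0.1 * |x - y| := by
    intro x y
    refine (norm_upper_sub_le_of_comp hs (by norm_num) hLip x y).trans ?_
    gcongr
    rw [div_le_iff₀ (by linarith)]
    linarith
  have hLV : ∀ x y : ℝ, ‖V x - V y‖ ≤ 0.1 * |x - y| := by
    intro x y
    exact convex_univ.norm_image_sub_le_of_norm_hasDerivWithin_le (f := fun t : ℝ => V t) (C := 0.1)
      (fun t _ => (hVd t).hasDerivWithinAt)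
      (fun t _ => (hbd t).1.trans (by norm_num)) (Set.mem_univ y) (Set.mem_univ x)
  refine ⟨fun x => ⟨(hVd x).differentiableAt, ?_⟩, fun y => ?_,
    fun z hz => hV.norm_deriv_le_of_lipschitz hLV hz,
    fun z hz => hU.norm_deriv_le_of_lipschitz hLU hz⟩
  · rw [(hVd x).deriv]
    exact (hbd x).1.trans (by norm_num)
  · -- `U` is `U ∘ s` composed with the inverse of `s`
    let e : ℝ ≃o ℝ := StrictMono.orderIsoOfSurjective s hs.strictMono hs.surjective
    have he : ∀ t, s (e.symm t) = t := fun t => e.apply_symm_apply t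
    have hd : HasDerivAt e.symm (s' (e.symm y))⁻¹ y :=
      (hs.hasDerivAt (e.symm y)).of_local_left_inverse e.symm.continuous.continuousAt
        (hs.deriv_pos _).ne' (Eventually.of_forall he)
    have h1 : HasDerivAt (fun t : ℝ => U (s (e.symm t))) _ y :=
      (hcd (e.symm y)).scomp y hd
    simp_rw [he] at h1
    refine ⟨h1.differentiableAt, ?_⟩
    simpa using (h1.le_of_lip' (C := 0.1) (by norm_num)
      (Eventually.of_forall fun t => by simpa using hLU t y)) |> fun h => h1.deriv ▸ h

end Estimates

/-! ### Characteristics of an integrable field -/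

/-- A continuous field `f x y` with continuous derivative `f₁ = ∂ₓ f`, where `f`, `f₁` and the
Lipschitz constant of `f₁` in `x` have integrable bounds `m₁`, `m₂`, `m₃` in `y`. -/
structure IsIntegrableField (f f₁ : ℝ → ℝ → ℝ) (m₁ m₂ m₃ : ℝ → ℝ) : Prop where
  continuous : Continuous fun p : ℝ × ℝ => f p.1 p.2
  continuous_deriv : Continuous fun p : ℝ × ℝ => f₁ p.1 p.2
  hasDerivAt : ∀ x y, HasDerivAt (fun t => f t y) (f₁ x y) x
  abs_le : ∀ x y, |f x y| ≤ m₁ y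
  abs_deriv_le : ∀ x y, |f₁ x y| ≤ m₂ y
  lipschitz : ∀ x x' y, |f₁ x y - f₁ x' y| ≤ m₃ y * |x - x'|
  integrable₁ : Integrable m₁
  integrable₂ : Integrable m₂
  integrable₃ : Integrable m₃

theorem hasDerivAt_integral_Iic {g : ℝ → ℝ} (hc : Continuous g) (hi : Integrable g) (y : ℝ) :
    HasDerivAt (fun y => ∫ t in Set.Iic y, g t) (g y) y := by
  have e : (fun y => ∫ t in Set.Iic y, g t)
      = fun y => (∫ t in Set.Iic (0 : ℝ), g t) + ∫ t in (0 : ℝ)..y, g t := by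
    ext y
    rw [← intervalIntegral.integral_Iic_sub_Iic hi.integrableOn hi.integrableOn]
    ring
  rw [e]
  exact (intervalIntegral.integral_hasDerivAt_right (hc.intervalIntegrable _ _)
    (hc.stronglyMeasurableAtFilter _ _) hc.continuousAt).const_add _

theorem tendsto_integral_Iic_atBot {g : ℝ → ℝ} (hi : Integrable g) :
    Tendsto (fun y => ∫ t in Set.Iic y, g t) atBot (𝓝 0) := by
  have h := intervalIntegral_tendsto_integral_Iic (0 : ℝ) hi.integrableOn tendsto_id
  have h2 := (tendsto_const_nhds (x := ∫ t in Set.Iic (0 : ℝ), g t)).sub h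
  rw [sub_self] at h2
  refine h2.congr fun y => ?_
  rw [id, ← intervalIntegral.integral_Iic_sub_Iic hi.integrableOn hi.integrableOn]
  ring

theorem tendsto_integral_Iic_atTop {g : ℝ → ℝ} (hi : Integrable g) :
    Tendsto (fun y => ∫ t in Set.Iic y, g t) atTop (𝓝 (∫ t, g t)) := by
  have h := intervalIntegral_tendsto_integral_Ioi (0 : ℝ) hi.integrableOn tendsto_id
  have h2 := (tendsto_const_nhds (x := ∫ t in Set.Iic (0 : ℝ), g t)).add h
  rw [intervalIntegral.integral_Iic_add_Ioi hi.integrableOn hi.integrableOn] at h2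
  refine h2.congr fun y => ?_
  rw [id, ← intervalIntegral.integral_Iic_sub_Iic hi.integrableOn hi.integrableOn]
  ring

theorem abs_integral_Iic_le {g m : ℝ → ℝ} (hm : Integrable m) (h : ∀ t, |g t| ≤ m t) (y : ℝ) :
    |∫ t in Set.Iic y, g t| ≤ ∫ t, m t := by
  rw [← Real.norm_eq_abs]
  exact (norm_integral_le_of_norm_le hm.integrableOn (Eventually.of_forall h)).trans
    (setIntegral_le_integral hm (Eventually.of_forall fun t => (abs_nonneg _).trans (h t)))

namespace IsIntegrableField

variable {f f₁ : ℝ → ℝ → ℝ} {m₁ m₂ m₃ : ℝ → ℝ}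

theorem abs_sub_le (hf : IsIntegrableField f f₁ m₁ m₂ m₃) (x x' y : ℝ) :
    |f x y - f x' y| ≤ m₂ y * |x - x'| :=
  convex_univ.norm_image_sub_le_of_norm_hasDerivWithin_le
    (fun t _ => (hf.hasDerivAt t y).hasDerivWithinAt) (fun t _ => hf.abs_deriv_le t y)
    (Set.mem_univ x') (Set.mem_univ x)

theorem integrable_comp (hf : IsIntegrableField f f₁ m₁ m₂ m₃) {x : ℝ → ℝ} (hx : Continuous x) :
    Integrable fun y => f (x y) y :=
  hf.integrable₁.mono' (hf.continuous.comp (hx.prodMk continuous_id)).aestronglyMeasurable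
    (Eventually.of_forall fun y => hf.abs_le (x y) y)

theorem integrable_deriv_comp (hf : IsIntegrableField f f₁ m₁ m₂ m₃) {x : ℝ → ℝ}
    (hx : Continuous x) : Integrable fun y => f₁ (x y) y :=
  hf.integrable₂.mono' (hf.continuous_deriv.comp (hx.prodMk continuous_id)).aestronglyMeasurable
    (Eventually.of_forall fun y => hf.abs_deriv_le (x y) y)

open scoped BoundedContinuousFunction in
/-- Existence of characteristics with given asymptotics, by the contraction principle for the
integral equation starting at `-∞`. -/
theorem exists_characteristic (hf : IsIntegrableField f f₁ m₁ m₂ m₃) (hm : ∫ y, m₂ y < 1)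
    (lam ξ : ℝ) : ∃ (x : ℝ → ℝ) (η : ℝ), (∀ y, HasDerivAt x (lam + f (x y) y) y) ∧
      Tendsto (fun y => x y - lam * y) atBot (𝓝 ξ) ∧
      Tendsto (fun y => x y - lam * y) atTop (𝓝 η) := by
  have hpath : ∀ w : ℝ →ᵇ ℝ, Continuous fun t => ξ + lam * t + w t := fun w => by
    have := w.continuous
    fun_prop
  have hg : ∀ w : ℝ →ᵇ ℝ, Continuous fun t => f (ξ + lam * t + w t) t := fun w =>
    hf.continuous.comp ((hpath w).prodMk continuous_id)
  have hi : ∀ w : ℝ →ᵇ ℝ, Integrable fun t => f (ξ + lam * t + w t) t := fun w =>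
    hf.integrable_comp (hpath w)
  let T : (ℝ →ᵇ ℝ) → (ℝ →ᵇ ℝ) := fun w =>
    BoundedContinuousFunction.ofNormedAddCommGroup
      (fun y => ∫ t in Set.Iic y, f (ξ + lam * t + w t) t)
      (continuous_iff_continuousAt.mpr fun y =>
        (hasDerivAt_integral_Iic (hg w) (hi w) y).continuousAt)
      (∫ y, m₁ y) (abs_integral_Iic_le hf.integrable₁ fun t => hf.abs_le _ t)
  have hm0 : 0 ≤ ∫ y, m₂ y :=
    integral_nonneg fun y => (abs_nonneg _).trans (hf.abs_deriv_le 0 y)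
  have hT : ContractingWith ⟨∫ y, m₂ y, hm0⟩ T := by
    refine ⟨by exact_mod_cast hm, LipschitzWith.of_dist_le_mul fun w w' => ?_⟩
    refine (BoundedContinuousFunction.dist_le (by positivity)).mpr fun y => ?_
    show |(∫ t in Set.Iic y, f (ξ + lam * t + w t) t)
      - ∫ t in Set.Iic y, f (ξ + lam * t + w' t) t| ≤ (∫ y, m₂ y) * dist w w'
    rw [← integral_sub (hi w).integrableOn (hi w').integrableOn, ← integral_mul_const]
    refine abs_integral_Iic_le (hf.integrable₂.mul_const _) (fun t => ?_) y
    refine (hf.abs_sub_le _ _ t).trans ?_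
    have h1 : |ξ + lam * t + w t - (ξ + lam * t + w' t)| ≤ dist w w' := by
      rw [add_sub_add_left_eq_sub]
      exact BoundedContinuousFunction.dist_coe_le_dist (f := w) (g := w') t
    exact mul_le_mul_of_nonneg_left h1 ((abs_nonneg _).trans (hf.abs_deriv_le 0 t))
  obtain ⟨w, hw, -⟩ := hT.exists_fixedPoint 0 (edist_ne_top _ _)
  have hwy : ∀ y, w y = ∫ t in Set.Iic y, f (ξ + lam * t + w t) t := fun y =>
    (congrArg (fun u : ℝ →ᵇ ℝ => u y) hw).symm
  have hxy : ∀ y, ξ + lam * y + w y - lam * y = ξ + ∫ t in Set.Iic y, f (ξ + lam * t + w t) t :=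
    fun y => by rw [← hwy]; ring
  refine ⟨fun y => ξ + lam * y + w y, ξ + ∫ t, f (ξ + lam * t + w t) t, fun y => ?_, ?_, ?_⟩
  · have h1 := hasDerivAt_integral_Iic (hg w) (hi w) y
    have h2 : HasDerivAt w (f (ξ + lam * y + w y) y) y := by
      refine h1.congr_of_eventuallyEq (Eventually.of_forall hwy)
    have h3 : HasDerivAt (fun y : ℝ => ξ + lam * y) lam y := by
      simpa using ((hasDerivAt_id y).const_mul lam).const_add ξ
    exact h3.add h2
  · simp_rw [hxy]
    simpa using (tendsto_integral_Iic_atBot (hi w)).const_add ξ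
  · simp_rw [hxy]
    exact (tendsto_integral_Iic_atTop (hi w)).const_add ξ

/-- Comparison of two characteristics: their distance is multiplied by the exponential of an
integral of `f₁`. -/
theorem characteristic_sub (hf : IsIntegrableField f f₁ m₁ m₂ m₃) {lam ξ ξ' η η' : ℝ}
    {x x' : ℝ → ℝ} (hx : ∀ y, HasDerivAt x (lam + f (x y) y) y)
    (hx' : ∀ y, HasDerivAt x' (lam + f (x' y) y) y)
    (hξ : Tendsto (fun y => x y - lam * y) atBot (𝓝 ξ))
    (hξ' : Tendsto (fun y => x' y - lam * y) atBot (𝓝 ξ'))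
    (hη : Tendsto (fun y => x y - lam * y) atTop (𝓝 η))
    (hη' : Tendsto (fun y => x' y - lam * y) atTop (𝓝 η')) :
    (∃ E : ℝ, η' - η = (ξ' - ξ) * Real.exp E ∧
      |E - ∫ y, f₁ (x y) y| ≤ (∫ y, m₃ y) * (Real.exp (∫ y, m₂ y) * |ξ' - ξ|)) ∧
    |(∫ y, f₁ (x' y) y) - ∫ y, f₁ (x y) y|
      ≤ (∫ y, m₃ y) * (Real.exp (∫ y, m₂ y) * |ξ' - ξ|) := by
  have hxc : Continuous x := continuous_iff_continuousAt.mpr fun y => (hx y).continuousAt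
  have hxc' : Continuous x' := continuous_iff_continuousAt.mpr fun y => (hx' y).continuousAt
  -- the averaged derivative along the segment between the two characteristics
  set c : ℝ → ℝ := fun y => ∫ t in (0 : ℝ)..1, f₁ (x y + t * (x' y - x y)) y with hcdef
  have hcu : Continuous (Function.uncurry fun y t : ℝ => f₁ (x y + t * (x' y - x y)) y) :=
    hf.continuous_deriv.comp (by fun_prop :
      Continuous fun p : ℝ × ℝ => (x p.1 + p.2 * (x' p.1 - x p.1), p.1))
  have hcc : Continuous c :=
    intervalIntegral.continuous_parametric_intervalIntegral_of_continuous' hcu 0 1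
  have hct : ∀ y, Continuous fun t : ℝ => f₁ (x y + t * (x' y - x y)) y := fun y =>
    hcu.comp (Continuous.prodMk_right y)
  have hcm : ∀ y, |c y| ≤ m₂ y := by
    intro y
    have := intervalIntegral.norm_integral_le_of_norm_le_const (a := (0 : ℝ)) (b := 1)
      (f := fun t : ℝ => f₁ (x y + t * (x' y - x y)) y) (C := m₂ y)
      (fun t _ => hf.abs_deriv_le _ y)
    simpa using this
  have hci : Integrable c :=
    hf.integrable₂.mono' hcc.aestronglyMeasurable (Eventually.of_forall hcm)
  have hfc : ∀ y, f (x' y) y - f (x y) y = (x' y - x y) * c y := by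
    intro y
    have hder : ∀ t ∈ Set.uIcc (0 : ℝ) 1, HasDerivAt (fun t : ℝ => f (x y + t * (x' y - x y)) y)
        (f₁ (x y + t * (x' y - x y)) y * (x' y - x y)) t := by
      intro t _
      have h1 : HasDerivAt (fun t : ℝ => x y + t * (x' y - x y)) (x' y - x y) t := by
        simpa using ((hasDerivAt_id t).mul_const (x' y - x y)).const_add (x y)
      exact (hf.hasDerivAt _ y).comp t h1
    have h := intervalIntegral.integral_eq_sub_of_hasDerivAt hder
      (((hct y).mul_const _).intervalIntegrable _ _)
    rw [intervalIntegral.integral_mul_const] at h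
    simp only [one_mul, zero_mul, add_zero, add_sub_cancel] at h
    rw [← h, mul_comm]
  -- the distance divided by the integrating factor is constant
  set P : ℝ → ℝ := fun y => ∫ t in Set.Iic y, c t with hP
  have hPd := hasDerivAt_integral_Iic hcc hci
  have hconst : ∀ y, (x' y - x y) * Real.exp (-P y) = (x' 0 - x 0) * Real.exp (-P 0) := by
    intro y
    refine is_const_of_deriv_eq_zero (f := fun y => (x' y - x y) * Real.exp (-P y)) ?_ ?_ y 0
    all_goals
      have hd : ∀ y, HasDerivAt (fun y => (x' y - x y) * Real.exp (-P y)) 0 y := fun y => by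
        refine (((hx' y).sub (hx y)).mul (hPd y).neg.exp).congr_deriv ?_
        have := hfc y
        simp only [Pi.sub_apply]
        linear_combination Real.exp (-P y) * this
    · exact fun y => (hd y).differentiableAt
    · exact fun y => (hd y).deriv
  have hsub : ∀ y, x' y - x y = (x' y - lam * y) - (x y - lam * y) := fun y => by ring
  have hdbot : Tendsto (fun y => (x' y - x y) * Real.exp (-P y)) atBot (𝓝 (ξ' - ξ)) := by
    have h1 := (hξ'.sub hξ).mul ((tendsto_integral_Iic_atBot hci).neg.rexp)
    simp only [neg_zero, Real.exp_zero, mul_one] at h1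
    exact h1.congr fun y => by rw [hsub y]
  have hdtop : Tendsto (fun y => (x' y - x y) * Real.exp (-P y)) atTop
      (𝓝 ((η' - η) * Real.exp (-∫ t, c t))) := by
    have h1 := (hη'.sub hη).mul ((tendsto_integral_Iic_atTop hci).neg.rexp)
    exact h1.congr fun y => by rw [hsub y]
  simp_rw [hconst] at hdbot hdtop
  have e1 := tendsto_nhds_unique tendsto_const_nhds hdbot
  have e2 := tendsto_nhds_unique tendsto_const_nhds hdtop
  have hd : ∀ y, x' y - x y = (ξ' - ξ) * Real.exp (P y) := by
    intro y
    rw [← e1, ← hconst y, mul_assoc, ← Real.exp_add, neg_add_cancel, Real.exp_zero, mul_one]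
  have hdle : ∀ y, |x' y - x y| ≤ Real.exp (∫ y, m₂ y) * |ξ' - ξ| := by
    intro y
    rw [hd, abs_mul, Real.abs_exp, mul_comm]
    gcongr
    exact (le_abs_self _).trans (abs_integral_Iic_le hf.integrable₂ hcm y)
  have hm3 : ∀ y, 0 ≤ m₃ y := fun y => by
    simpa using (abs_nonneg _).trans (hf.lipschitz 1 0 y)
  have hI : ∀ g : ℝ → ℝ, Integrable g → (∀ y, |g y - f₁ (x y) y| ≤ m₃ y * |x' y - x y|) →
      |(∫ y, g y) - ∫ y, f₁ (x y) y| ≤ (∫ y, m₃ y) * (Real.exp (∫ y, m₂ y) * |ξ' - ξ|) := by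
    intro g hg hle
    rw [← integral_sub hg (hf.integrable_deriv_comp hxc), ← integral_mul_const]
    rw [← Real.norm_eq_abs]
    refine norm_integral_le_of_norm_le (hf.integrable₃.mul_const _)
      (Eventually.of_forall fun y => ?_)
    refine (hle y).trans ?_
    exact mul_le_mul_of_nonneg_left (hdle y) (hm3 y)
  refine ⟨⟨∫ y, c y, ?_, hI c hci fun y => ?_⟩,
    hI _ (hf.integrable_deriv_comp hxc') fun y => hf.lipschitz _ _ y⟩
  · rw [← e1, e2, mul_assoc, ← Real.exp_add, neg_add_cancel, Real.exp_zero, mul_one]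
  · have e : c y - f₁ (x y) y
        = ∫ t in (0 : ℝ)..1, (f₁ (x y + t * (x' y - x y)) y - f₁ (x y) y) := by
      rw [intervalIntegral.integral_sub ((hct y).intervalIntegrable _ _) (by simp)]
      simp [hcdef]
    rw [e]
    have := intervalIntegral.norm_integral_le_of_norm_le_const (a := (0 : ℝ)) (b := 1)
      (f := fun t : ℝ => f₁ (x y + t * (x' y - x y)) y - f₁ (x y) y)
      (C := m₃ y * |x' y - x y|) (fun t ht => ?_)
    · simpa using this
    · rw [Set.uIoc_of_le zero_le_one] at ht
      refine (hf.lipschitz _ _ y).trans (mul_le_mul_of_nonneg_left ?_ (hm3 y))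
      rw [add_sub_cancel_left, abs_mul, abs_of_pos ht.1]
      exact mul_le_of_le_one_left (abs_nonneg _) ht.2

theorem abs_characteristic_shift_le (hf : IsIntegrableField f f₁ m₁ m₂ m₃) {lam ξ η : ℝ}
    {x : ℝ → ℝ} (hx : ∀ y, HasDerivAt x (lam + f (x y) y) y)
    (hξ : Tendsto (fun y => x y - lam * y) atBot (𝓝 ξ))
    (hη : Tendsto (fun y => x y - lam * y) atTop (𝓝 η)) : |η - ξ| ≤ ∫ y, m₁ y := by
  have hxc : Continuous x := continuous_iff_continuousAt.mpr fun y => (hx y).continuousAt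
  have hd : ∀ y, HasDerivAt (fun y => x y - lam * y) (f (x y) y) y := fun y => by
    have := (hx y).fun_sub ((hasDerivAt_id y).const_mul lam)
    simpa using this
  rw [← Real.norm_eq_abs, ← integral_of_hasDerivAt_of_tendsto hd (hf.integrable_comp hxc) hξ hη]
  exact norm_integral_le_of_norm_le hf.integrable₁
    (Eventually.of_forall fun y => hf.abs_le (x y) y)

end IsIntegrableField

/-! ### The scattering shift of a small potential -/

theorem exp_sub_exp_le {a b M : ℝ} (ha : a ≤ M) (hb : b ≤ M) :
    |Real.exp a - Real.exp b| ≤ Real.exp M * |a - b| :=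
  (convex_Iic M).norm_image_sub_le_of_norm_hasDerivWithin_le
    (fun t _ => (Real.hasDerivAt_exp t).hasDerivWithinAt)
    (fun t ht => by rw [Real.norm_eq_abs, Real.abs_exp]; exact Real.exp_le_exp.mpr ht) hb ha

/-- The scattering map of an integrable field is close to the identity. -/
theorem IsIntegrableField.isNearId {f f₁ : ℝ → ℝ → ℝ} {m₁ m₂ m₃ : ℝ → ℝ}
    (hf : IsIntegrableField f f₁ m₁ m₂ m₃) {lam : ℝ} {s : ℝ → ℝ} {x : ℝ → ℝ → ℝ}
    (hx : ∀ ξ y, HasDerivAt (x ξ) (lam + f (x ξ y) y) y)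
    (hξ : ∀ ξ, Tendsto (fun y => x ξ y - lam * y) atBot (𝓝 ξ))
    (hη : ∀ ξ, Tendsto (fun y => x ξ y - lam * y) atTop (𝓝 (s ξ)))
    (hm : Real.exp (∫ y, m₂ y) - 1 < 1) :
    IsNearId s (fun ξ => Real.exp (∫ y, f₁ (x ξ y) y)) (∫ y, m₁ y) (Real.exp (∫ y, m₂ y) - 1)
      ((∫ y, m₃ y) * Real.exp (∫ y, m₂ y) ^ 2) := by
  set M := ∫ y, m₂ y with hM
  have hI : ∀ ξ, |∫ y, f₁ (x ξ y) y| ≤ M := fun ξ => by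
    rw [← Real.norm_eq_abs]
    exact norm_integral_le_of_norm_le hf.integrable₂
      (Eventually.of_forall fun y => hf.abs_deriv_le (x ξ y) y)
  have hcmp := fun ξ ξ' => hf.characteristic_sub (hx ξ) (hx ξ') (hξ ξ) (hξ ξ') (hη ξ) (hη ξ')
  refine ⟨fun ξ => ?_, fun ξ => hf.abs_characteristic_shift_le (hx ξ) (hξ ξ) (hη ξ), fun ξ => ?_,
    fun ξ ξ' => ?_, hm⟩
  · choose E hE1 hE2 using fun ξ' => (hcmp ξ ξ').1
    have hlim : Tendsto E (𝓝 ξ) (𝓝 (∫ y, f₁ (x ξ y) y)) := by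
      rw [tendsto_iff_norm_sub_tendsto_zero]
      refine squeeze_zero (fun _ => norm_nonneg _) hE2 ?_
      have : Continuous fun ξ' => (∫ y, m₃ y) * (Real.exp M * |ξ' - ξ|) := by fun_prop
      simpa using this.tendsto ξ
    rw [hasDerivAt_iff_tendsto_slope]
    refine ((hlim.mono_left nhdsWithin_le_nhds).rexp).congr' ?_
    filter_upwards [self_mem_nhdsWithin] with ξ' hne
    have : ξ' - ξ ≠ 0 := sub_ne_zero.mpr hne
    rw [slope_def_field, hE1 ξ']
    field_simp
  · obtain ⟨h1, h2⟩ := _root_.abs_le.mp (hI ξ)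
    have h3 := Real.exp_le_exp.mpr h2
    have h4 := Real.add_one_le_exp (∫ y, f₁ (x ξ y) y)
    have h5 := Real.add_one_le_exp M
    rw [_root_.abs_le]; constructor <;> linarith
  · have h1 := (hcmp ξ' ξ).2
    have h2 := exp_sub_exp_le (_root_.abs_le.mp (hI ξ)).2 (_root_.abs_le.mp (hI ξ')).2
    calc _ ≤ _ := h2
      _ ≤ Real.exp M * ((∫ y, m₃ y) * (Real.exp M * |ξ - ξ'|)) := by gcongr
      _ = _ := by ring

/-- The iterated `x`-derivatives of a smooth compactly supported function are again such functions
of both variables. -/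
theorem exists_contDiff_dx {v : ℝ × ℝ → ℝ} (hv : ContDiff ℝ (⊤ : ℕ∞) v) (hs : HasCompactSupport v)
    (k : ℕ) : ∃ g : ℝ × ℝ → ℝ, ContDiff ℝ (⊤ : ℕ∞) g ∧ HasCompactSupport g ∧
      ∀ x y, dx k v x y = g (x, y) := by
  induction k with
  | zero => exact ⟨v, hv, hs, fun x y => by simp [dx]⟩
  | succ k ih =>
    obtain ⟨g, hg, hgs, hgd⟩ := ih
    refine ⟨fun p => fderiv ℝ g p (1, 0), ?_, ?_, fun x y => ?_⟩
    · exact (hg.fderiv_right (m := (⊤ : ℕ∞)) (by simp)).clm_apply contDiff_const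
    · exact (hgs.fderiv (𝕜 := ℝ)).comp_left (g := fun L : ℝ × ℝ →L[ℝ] ℝ => L (1, 0)) (by simp)
    · rw [dx, iteratedDeriv_succ]
      have e : (iteratedDeriv k fun s => v (s, y)) = fun s => g (s, y) := funext fun s => hgd s y
      rw [e]
      have h1 : HasFDerivAt g (fderiv ℝ g (x, y)) (x, y) :=
        (hg.differentiable (by simp) (x, y)).hasFDerivAt
      have h2 : HasDerivAt (fun s : ℝ => (s, y)) ((1 : ℝ), (0 : ℝ)) x :=
        (hasDerivAt_id x).prodMk (hasDerivAt_const x y)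
      exact (h1.comp_hasDerivAt x h2).deriv

theorem hasDerivAt_dx {v : ℝ × ℝ → ℝ} (hv : ContDiff ℝ (⊤ : ℕ∞) v) (hs : HasCompactSupport v)
    (k : ℕ) (x y : ℝ) : HasDerivAt (fun t => dx k v t y) (dx (k + 1) v x y) x := by
  obtain ⟨g, hg, -, hgd⟩ := exists_contDiff_dx hv hs k
  have e : (fun t => dx k v t y) = fun t => g (t, y) := funext fun t => hgd t y
  have hd : DifferentiableAt ℝ (fun t => dx k v t y) x := by
    rw [e]
    exact (hg.differentiable (by simp) (x, y)).comp x (by fun_prop)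
  have h := hd.hasDerivAt
  have e2 : deriv (fun t => dx k v t y) x = dx (k + 1) v x y := by
    rw [dx, iteratedDeriv_succ]; rfl
  rwa [e2] at h

theorem continuous_dx {v : ℝ × ℝ → ℝ} (hv : ContDiff ℝ (⊤ : ℕ∞) v) (hs : HasCompactSupport v)
    (k : ℕ) : Continuous fun p : ℝ × ℝ => dx k v p.1 p.2 := by
  obtain ⟨g, hg, -, hgd⟩ := exists_contDiff_dx hv hs k
  simp_rw [hgd]
  exact hg.continuous

theorem abs_dx_le_iSup {v : ℝ × ℝ → ℝ} (hv : ContDiff ℝ (⊤ : ℕ∞) v) (hs : HasCompactSupport v)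
    (k : ℕ) : (∀ x y, |dx k v x y| ≤ ⨆ x', |dx k v x' y|) ∧
      Integrable fun y => ⨆ x, |dx k v x y| := by
  obtain ⟨g, hg, hgs, hgd⟩ := exists_contDiff_dx hv hs k
  simp_rw [hgd]
  obtain ⟨N, hN⟩ := hgs.exists_bound_of_continuous hg.continuous
  have hbdd : ∀ y, BddAbove (Set.range fun x => |g (x, y)|) := fun y =>
    ⟨N, by rintro _ ⟨x, rfl⟩; exact hN (x, y)⟩
  refine ⟨fun x y => le_ciSup (hbdd y) x, ?_⟩
  have hlsc : LowerSemicontinuous fun y => ⨆ x, |g (x, y)| :=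
    lowerSemicontinuous_ciSup hbdd fun x => by
      have := hg.continuous
      exact (by fun_prop : Continuous fun y => |g (x, y)|).lowerSemicontinuous
  have hK : IsCompact (Prod.snd '' tsupport g) := hgs.isCompact.image continuous_snd
  have hi : Integrable ((Prod.snd '' tsupport g).indicator fun _ => N) :=
    (integrable_indicator_iff hK.measurableSet).mpr (integrableOn_const hK.measure_lt_top.ne)
  refine hi.mono' hlsc.measurable.aestronglyMeasurable (Eventually.of_forall fun y => ?_)
  rw [Real.norm_of_nonneg (Real.iSup_nonneg fun x => abs_nonneg _)]
  by_cases hy : y ∈ Prod.snd '' tsupport g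
  · rw [Set.indicator_of_mem hy]
    exact ciSup_le fun x => hN (x, y)
  · rw [Set.indicator_of_notMem hy]
    refine ciSup_le fun x => ?_
    have : g (x, y) = 0 := image_eq_zero_of_notMem_tsupport fun h => hy ⟨(x, y), h, rfl⟩
    simp [this]

theorem isIntegrableField_dx {v : ℝ × ℝ → ℝ} (hv : ContDiff ℝ (⊤ : ℕ∞) v)
    (hs : HasCompactSupport v) :
    IsIntegrableField (dx 1 v) (dx 2 v) (fun y => ⨆ x, |dx 1 v x y|) (fun y => ⨆ x, |dx 2 v x y|)
      (fun y => ⨆ x, |dx 3 v x y|) where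
  continuous := continuous_dx hv hs 1
  continuous_deriv := continuous_dx hv hs 2
  hasDerivAt := hasDerivAt_dx hv hs 1
  abs_le := (abs_dx_le_iSup hv hs 1).1
  abs_deriv_le := (abs_dx_le_iSup hv hs 2).1
  lipschitz := fun x x' y => convex_univ.norm_image_sub_le_of_norm_hasDerivWithin_le
    (fun t _ => (hasDerivAt_dx hv hs 2 t y).hasDerivWithinAt)
    (fun t _ => (abs_dx_le_iSup hv hs 3).1 t y) (Set.mem_univ x') (Set.mem_univ x)
  integrable₁ := (abs_dx_le_iSup hv hs 1).2
  integrable₂ := (abs_dx_le_iSup hv hs 2).2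
  integrable₃ := (abs_dx_le_iSup hv hs 3).2

theorem supInt_nonneg (k : ℕ) (v : ℝ × ℝ → ℝ) : 0 ≤ supInt k v :=
  integral_nonneg fun _ => Real.iSup_nonneg fun _ => abs_nonneg _

theorem l2Int_nonneg (k : ℕ) (v : ℝ × ℝ → ℝ) : 0 ≤ l2Int k v :=
  integral_nonneg fun _ => Real.sqrt_nonneg _

theorem tan_pi_div_eight : Real.tan (Real.pi / 8) = √2 - 1 := by
  have h2 : Real.sqrt 2 ^ 2 = 2 := Real.sq_sqrt (by norm_num)
  have hlt : √2 < 2 := by nlinarith [Real.sqrt_nonneg 2]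
  have hp : 0 < √(2 + √2) := Real.sqrt_pos.mpr (by positivity)
  have e : √(2 - √2) = (√2 - 1) * √(2 + √2) := by
    have h1 : (0 : ℝ) ≤ √2 - 1 := by
      have := Real.one_le_sqrt.mpr (by norm_num : (1 : ℝ) ≤ 2); linarith
    rw [← Real.sqrt_sq h1, ← Real.sqrt_mul (sq_nonneg _)]
    congr 1
    nlinarith
  rw [Real.tan_eq_sin_div_cos, Real.sin_pi_div_eight, Real.cos_pi_div_eight, e]
  field_simp

/-- The three numerical consequences of the small norm condition that enter the estimates. -/
theorem SmallNorm.bounds {v : ℝ × ℝ → ℝ} (h : SmallNorm v) :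
    B0 v ≤ 1 / 4 ∧ B1 v ≤ 0.01852 ∧ B2 v ≤ 0.7854 := by
  have hpi := Real.pi_pos
  have hpi4 := Real.pi_lt_d4
  have hs2 : √2 < 1.41422 := by
    rw [Real.sqrt_lt' (by norm_num)]; norm_num
  have hB0 : 0 ≤ B0 v := supInt_nonneg 1 v
  have hB1 : 0 ≤ B1 v := by
    have := Real.add_one_le_exp (supInt 2 v)
    have := supInt_nonneg 2 v
    unfold B1; linarith
  have hB2 : 0 ≤ B2 v := mul_nonneg (supInt_nonneg 3 v) (by positivity)
  have hB3 : 0 ≤ B3 v := by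
    have := supInt_nonneg 3 v
    have := supInt_nonneg 4 v
    unfold B3; positivity
  have hb0 : 0 ≤ Bhat0 v := mul_nonneg (l2Int_nonneg 1 v) (by positivity)
  have hb1 : 0 ≤ Bhat1 v := mul_nonneg (l2Int_nonneg 2 v) (by positivity)
  refine ⟨h.cond1, ?_, ?_⟩
  · have h4 := h.cond4
    rw [tan_pi_div_eight] at h4
    have t1 : 0 ≤ 1 / Real.pi * (8 * B3 v + 16 * B2 v ^ 2 + 56 * B1 v + 16 * B1 v ^ 2)
        * (B0 v + 2 / Real.pi * (2 * B0 v + Bhat0 v)) := by positivity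
    have t2 : 20.3717 * B1 v ≤ 1 / Real.pi * (64 * B1 v + 16 * Bhat1 v) := by
      rw [one_div, ← div_eq_inv_mul, le_div_iff₀ hpi]
      nlinarith
    linarith
  · have h3 := h.cond3
    have : 0 ≤ 2 * √2 * Bhat0 v := by positivity
    linarith

/-- The map `ξ ↦ ξ + σ (ξ, lam)` is close to the identity. -/
theorem SmallNorm.exists_isNearId {v : ℝ × ℝ → ℝ} (hv : ContDiff ℝ (⊤ : ℕ∞) v)
    (hs : HasCompactSupport v) (h : SmallNorm v) (lam : ℝ) :
    ∃ s' : ℝ → ℝ, IsNearId (fun ξ => ξ + sigma v ξ lam) s' (B0 v) (B1 v) (B2 v) := by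
  have hf := isIntegrableField_dx hv hs
  obtain ⟨-, h1, -⟩ := h.bounds
  have hm0 : 0 ≤ supInt 2 v := supInt_nonneg 2 v
  have hB1 : B1 v = Real.exp (supInt 2 v) - 1 := rfl
  have hm : supInt 2 v < 1 := by
    have := Real.add_one_le_exp (supInt 2 v)
    linarith
  have hex : ∀ ξ, Scatters v ξ lam (sigma v ξ lam) := by
    intro ξ
    refine Classical.epsilon_spec (p := Scatters v ξ lam) ?_
    obtain ⟨x, η, hx, hξ, hη⟩ := hf.exists_characteristic hm lam ξ
    exact ⟨η - ξ, x, hx, hξ, by rwa [add_sub_cancel]⟩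
  choose x hx hξ hη using hex
  have hN := hf.isNearId (s := fun ξ => ξ + sigma v ξ lam) hx hξ hη
    (show Real.exp (supInt 2 v) - 1 < 1 by linarith)
  refine ⟨_, hN.hasDerivAt, hN.abs_sub_le, hN.abs_deriv_sub_le, fun ξ ξ' => ?_, hN.lt_one⟩
  refine (hN.lipschitz ξ ξ').trans ?_
  refine mul_le_mul_of_nonneg_right ?_ (abs_nonneg _)
  show supInt 3 v * Real.exp (supInt 2 v) ^ 2 ≤ supInt 3 v * (1 + B1 v) ^ 3
  rw [hB1, add_sub_cancel]
  exact mul_le_mul_of_nonneg_left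
    (pow_le_pow_right₀ (Real.one_le_exp hm0) (by norm_num)) (supInt_nonneg 3 v)

open Classical in
/-- A function on the upper half-plane with prescribed values on the real line. -/
noncomputable def upperExtension (χ : ℂ → ℂ) (χp : ℝ → ℂ) (z : ℂ) : ℂ :=
  if 0 < z.im then χ z else χp z.re

theorem upperExtension_of_pos {χ : ℂ → ℂ} {χp : ℝ → ℂ} {z : ℂ} (hz : 0 < z.im) :
    upperExtension χ χp z = χ z := if_pos hz

theorem upperExtension_ofReal {χ : ℂ → ℂ} {χp : ℝ → ℂ} (x : ℝ) :
    upperExtension χ χp x = χp x := by simp [upperExtension]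

theorem deriv_upperExtension {χ : ℂ → ℂ} {χp : ℝ → ℂ} {z : ℂ} (hz : 0 < z.im) :
    deriv (upperExtension χ χp) z = deriv χ z := by
  refine EventuallyEq.deriv_eq ?_
  filter_upwards [isOpen_upper.mem_nhds hz] with w hw using upperExtension_of_pos hw

/-- Holomorphic functions on the upper half-plane with boundary values everywhere on the real line
that are bounded near infinity. -/
theorem isUpperBdd_upperExtension {χ : ℂ → ℂ} {χp : ℝ → ℂ}
    (hd : DifferentiableOn ℂ χ {z | 0 < z.im})
    (hb : ∀ x : ℝ, Tendsto χ (𝓝[{z | 0 < z.im}] (x : ℂ)) (𝓝 (χp x)))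
    (hK : ∃ K : Set ℂ, IsCompact K ∧ ∀ z, z ∉ K → 0 < z.im → ‖χ z‖ ≤ 1) :
    IsUpperBdd (upperExtension χ χp) := by
  have hcl : closure {z : ℂ | 0 < z.im} = {z : ℂ | 0 ≤ z.im} := Complex.closure_setOfPred_lt_im 0
  have hreal : ∀ z : ℂ, z.im = 0 → z = (z.re : ℂ) := fun z hz => by
    apply Complex.ext <;> simp [hz]
  have hlim : ∀ z : ℂ, 0 ≤ z.im →
      Tendsto χ (𝓝[{z | 0 < z.im}] z) (𝓝 (upperExtension χ χp z)) := by
    intro z hz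
    rcases hz.lt_or_eq with h | h
    · rw [upperExtension_of_pos h]
      exact hd.continuousOn z h
    · rw [hreal z h.symm, upperExtension_ofReal]
      exact hb z.re
  have hcont : ContinuousOn (upperExtension χ χp) {z | 0 ≤ z.im} := by
    have h1 : ContinuousOn (extendFrom {z | 0 < z.im} χ) {z : ℂ | 0 ≤ z.im} :=
      continuousOn_extendFrom hcl.ge fun z hz => ⟨_, hlim z hz⟩
    exact h1.congr fun z hz => (extendFrom_eq (hcl.ge hz) (hlim z hz)).symm
  refine ⟨hcont, hd.congr fun z hz => upperExtension_of_pos hz, ?_⟩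
  obtain ⟨K, hKc, hK1⟩ := hK
  have hclosed : IsClosed {z : ℂ | 0 ≤ z.im} := isClosed_le continuous_const continuous_im
  obtain ⟨N, hN⟩ := (hKc.inter_right hclosed).exists_bound_of_continuousOn
    (hcont.mono Set.inter_subset_right)
  refine ⟨max N 1, fun z hz => ?_⟩
  by_cases hzK : z ∈ K
  · exact (hN z ⟨hzK, hz⟩).trans (le_max_left _ _)
  · refine le_trans ?_ (le_max_right _ _)
    have : (𝓝[{z : ℂ | 0 < z.im}] z).NeBot :=
      mem_closure_iff_nhdsWithin_neBot.mp (hcl.ge hz)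
    refine le_of_tendsto (hlim z hz).norm ?_
    filter_upwards [self_mem_nhdsWithin,
      mem_nhdsWithin_of_mem_nhds (hKc.isClosed.isOpen_compl.mem_nhds hzK)] with w hw hwK
    exact hK1 w hwK hw

end Pavlov

theorem mainTheorem8 (v : SchwartzMap (ℝ × ℝ) ℝ) (hsupp : HasCompactSupport (v : ℝ × ℝ → ℝ))
    (hsmall : Pavlov.SmallNorm (v : ℝ × ℝ → ℝ))
    (lam : ℝ) (χ : ℂ → ℂ) (χp χm : ℝ → ℂ)
    (hχ : Pavlov.IsShiftedRHSolution (fun ξ => Pavlov.sigma (v : ℝ × ℝ → ℝ) ξ lam) χ χp χm) :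
    (∀ ξ : ℝ, DifferentiableAt ℝ χm ξ ∧ ‖deriv χm ξ‖ ≤ 1 / 4 * Real.tan (Real.pi / 8)) ∧
    (∀ ξ : ℝ, DifferentiableAt ℝ χp ξ ∧ ‖deriv χp ξ‖ ≤ 1 / 4 * Real.tan (Real.pi / 8)) ∧
    (∀ z : ℂ, z.im ≠ 0 → ‖deriv χ z‖ ≤ 1 / 4 * Real.tan (Real.pi / 8)) := by
  obtain ⟨s', hs⟩ := hsmall.exists_isNearId (v.smooth _) hsupp lam
  obtain ⟨hb0, hb1, hb2⟩ := hsmall.bounds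
  have hconst : (0.1 : ℝ) ≤ 1 / 4 * Real.tan (Real.pi / 8) := by
    have : (1.4142 : ℝ) ≤ √2 := Real.le_sqrt_of_sq_le (by norm_num)
    rw [Pavlov.tan_pi_div_eight]
    linarith
  -- a compact set outside which `χ` is at most `1`
  obtain ⟨K, hKc, hK⟩ : ∃ K : Set ℂ, IsCompact K ∧ ∀ z, z ∉ K → z.im ≠ 0 → ‖χ z‖ ≤ 1 := by
    have h1 := hχ.decay.norm.eventually (eventually_le_nhds (by simp : ‖(0 : ℂ)‖ < 1))
    rw [eventually_inf_principal] at h1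
    obtain ⟨K, hKc, hK⟩ := mem_cocompact.mp h1
    exact ⟨K, hKc, fun z hz => hK hz⟩
  have hU : Pavlov.IsUpperBdd (Pavlov.upperExtension χ χp) :=
    Pavlov.isUpperBdd_upperExtension (hχ.holomorphic.mono fun z hz => ne_of_gt hz)
      hχ.boundary_upper ⟨K, hKc, fun z hz hz' => hK z hz hz'.ne'⟩
  -- the lower function is the reflection of an upper one
  set W : ℂ → ℂ := Pavlov.upperExtension (fun z => χ (-z)) (fun x => χm (-x)) with hW
  have hWu : Pavlov.IsUpperBdd W := by
    refine Pavlov.isUpperBdd_upperExtension ?_ (fun x => ?_)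
      ⟨-K, hKc.neg, fun z hz hz' => hK (-z) (by simpa using hz) (by simpa using hz'.ne')⟩
    · refine hχ.holomorphic.comp differentiable_neg.differentiableOn fun z hz => ?_
      simpa using ne_of_gt hz
    · have h1 := hχ.boundary_lower (-x)
      refine h1.comp (tendsto_nhdsWithin_iff.mpr ⟨?_, ?_⟩)
      · have : Tendsto (fun z : ℂ => -z) (𝓝 (x : ℂ)) (𝓝 ((-x : ℝ) : ℂ)) := by
          simpa using (continuous_neg (G := ℂ)).tendsto (x : ℂ)
        exact this.mono_left nhdsWithin_le_nhds
      · filter_upwards [self_mem_nhdsWithin] with z hz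
        simpa using hz
  set V : ℂ → ℂ := fun z => W (-z) with hVdef
  have hV : Pavlov.IsLowerBdd V := by
    simpa [Pavlov.IsLowerBdd, hVdef] using hWu
  have hVr : ∀ x : ℝ, V x = χm x := by
    intro x
    have := Pavlov.upperExtension_ofReal (χ := fun z => χ (-z)) (χp := fun x => χm (-x)) (-x)
    simpa [hVdef, hW] using this
  have hj : ∀ x : ℝ, V x = ((x + Pavlov.sigma v x lam) - x : ℝ)
      + Pavlov.upperExtension χ χp ((x + Pavlov.sigma v x lam : ℝ) : ℂ) := by
    intro x
    rw [hVr, Pavlov.upperExtension_ofReal, add_sub_cancel_left]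
    linear_combination -hχ.jump x
  obtain ⟨r1, r2, r3, r4⟩ := Pavlov.deriv_bounds_of_isNearId hs hU hV hj hb0 hb1 hb2
  simp_rw [hVr] at r1
  simp_rw [Pavlov.upperExtension_ofReal] at r2
  refine ⟨fun ξ => ⟨(r1 ξ).1, (r1 ξ).2.trans hconst⟩, fun ξ => ⟨(r2 ξ).1, (r2 ξ).2.trans hconst⟩,
    fun z hz => le_trans ?_ hconst⟩
  rcases lt_or_gt_of_ne hz with h | h
  · have h1 := r3 z h
    have e : deriv V z = deriv χ z := by
      refine EventuallyEq.deriv_eq ?_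
      filter_upwards [(isOpen_lt Complex.continuous_im continuous_const).mem_nhds h] with w hw
      have hw : w.im < 0 := hw
      simp only [hVdef, hW]
      rw [Pavlov.upperExtension_of_pos (by simpa using hw), neg_neg]
    rwa [e] at h1
  · have h1 := r4 z h
    rwa [Pavlov.deriv_upperExtension h] at h1
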